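/- Let $n\ge 1$ and $\beta>0$. For $u\in L^2(\mathbb R^n)$ (complex valued) let $D^{-\beta}u=(-\Delta)^{-\beta/2}u$ be the Fourier multiplier with symbol $|\xi|^{-\beta}$ (in the normalisation in which $-\Delta$ has symbol $|\xi|^2$), and let $$X_\beta=H^1(\mathbb R^n)\cap\dot H^{-\beta}(\mathbb R^n)=\{u\in H^1(\mathbb R^n): D^{-\beta}u\in L^2(\mathbb R^n)\},\qquad \|u\|_{X_\beta}^2=\|u\|_{L^2}^2+\|\nabla u\|_{L^2}^2+\|D^{-\beta}u\|_{L^2}^2 .$$ Let $p>0$ be a real number, with $p\le \frac{4}{n-2}$ if $n\ge3$ (and no upper restriction on $p$ if $n\le 2$). Then there is a constant $\varrho=\varrho(p,\beta,n)>0$ such that $$\|u\|_{L^{p+2}(\mathbb R^n)}\le\varrho\,\|u\|_{L^2}^{\frac{4+p(2-n)}{2(p+2)}-\kappa}\,\|\nabla u\|_{L^2}^{\frac{np}{2(p+2)}+\frac{\kappa\beta}{\beta+1}}\,\|D^{-\beta}u\|_{L^2}^{\frac{\kappa}{\beta+1}}$$ for every $u\in X_\beta$ and every real $\kappa$ with $0\le\kappa\le\frac{4+p(2-n)}{2(p+2)}$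 (with $0^0=1$). In particular, $X_\beta$ is continuously embedded into $L^{p+2}(\mathbb R^n)$ for every such $p$. Furthermore, $X_\beta$ is compactly embedded into $L^q_{\rm loc}(\mathbb R^n)$ for every real $q\ge1$, with $q<\frac{2n}{n-2}$ if $n\ge3$: the inclusion is continuous, and every bounded sequence in $X_\beta$ has a subsequence that converges in $L^q(K)$ for every compact $K\subset\mathbb R^n$. -/

import Mathlib

open MeasureTheory Filter Topology TemperedDistribution
open scoped ENNReal FourierTransform SchwartzMap LineDeriv

/-- The complex Hilbert space `L²(ℝⁿ)`. -/
abbrev L2n (n : ℕ) : Type :=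
  Lp ℂ 2 (volume : Measure (EuclideanSpace ℝ (Fin n)))

/-- The symbol side of `D^{-β} u`: the function `|2πξ|^{-β} û(ξ)`. The factor `2π` belongs to the
normalisation `û(ξ) = ∫ e^{-2πi x·ξ} u(x) dx`, under which `D = (-Δ)^{1/2}` has symbol `|2πξ|`. -/
noncomputable def invRieszSymbol {n : ℕ} (β : ℝ) (u : L2n n) : EuclideanSpace ℝ (Fin n) → ℂ :=
  fun ξ => (((2 * Real.pi * ‖ξ‖) ^ (-β) : ℝ) : ℂ) * (𝓕 u : L2n n) ξ

open Classical in
/-- `D^{-β} u = L_{β/2} u`, the element of `L²` with Fourier transform `|2πξ|^{-β} û(ξ)`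
(and `0` when the latter is not square integrable). -/
noncomputable def invRiesz {n : ℕ} (β : ℝ) (u : L2n n) : L2n n :=
  if h : MemLp (invRieszSymbol β u) 2 volume then 𝓕⁻ (h.toLp (invRieszSymbol β u) : L2n n) else 0

open Classical in
/-- The distributional partial derivative `∂_j u`, as an element of `L²`
(and `0` when the distribution `∂_j u` is not in `L²`). -/
noncomputable def weakPartial {n : ℕ} (j : Fin n) (u : L2n n) : L2n n :=
  if h : ∃ g : L2n n,
      ∂_{EuclideanSpace.single j (1 : ℝ)} (u : 𝓢'(EuclideanSpace ℝ (Fin n), ℂ)) =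
        (g : 𝓢'(EuclideanSpace ℝ (Fin n), ℂ))
  then h.choose else 0

/-- For `u ∈ H¹` the function `weakPartial j u` is the distributional derivative of `u`. -/
theorem weakPartial_spec {n : ℕ} (j : Fin n) {u : L2n n}
    (hu : MemSobolev 1 2 (u : 𝓢'(EuclideanSpace ℝ (Fin n), ℂ))) :
    ∂_{EuclideanSpace.single j (1 : ℝ)} (u : 𝓢'(EuclideanSpace ℝ (Fin n), ℂ)) =
      (weakPartial j u : 𝓢'(EuclideanSpace ℝ (Fin n), ℂ)) := by
  have h1 := hu.lineDerivOp (m := EuclideanSpace.single j (1 : ℝ))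
  rw [sub_self, memSobolev_zero_iff] at h1
  unfold weakPartial
  rw [dif_pos h1]
  exact h1.choose_spec

/-- `‖∇u‖_{L²}`. -/
noncomputable def gradNorm {n : ℕ} (u : L2n n) : ℝ :=
  Real.sqrt (∑ j, ‖weakPartial j u‖ ^ 2)

/-- The energy space `X_β = H¹(ℝⁿ) ∩ Ḣ^{-β}(ℝⁿ)`. -/
noncomputable def XSpace (n : ℕ) (β : ℝ) : Submodule ℂ (L2n n) where
  carrier := {u | MemSobolev 1 2 (u : 𝓢'(EuclideanSpace ℝ (Fin n), ℂ)) ∧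
    MemLp (invRieszSymbol β u) 2 volume}
  zero_mem' := by
    constructor
    · rw [← Lp.toTemperedDistributionCLM_apply, map_zero]
      exact memSobolev_fun_zero _ _ 1 2
    · have h0 : (𝓕 (0 : L2n n) : L2n n) = 0 := (Lp.fourierTransformₗᵢ _ ℂ).map_zero
      refine (memLp_congr_ae ?_).2 (MemLp.zero' (ε := ℂ))
      unfold invRieszSymbol
      rw [h0]
      filter_upwards [Lp.coeFn_zero ℂ 2 (volume : Measure (EuclideanSpace ℝ (Fin n)))] with ξ hξ
      rw [hξ]
      simp
  add_mem' := by
    rintro u v ⟨hu1, hu2⟩ ⟨hv1, hv2⟩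
    constructor
    · rw [← Lp.toTemperedDistributionCLM_apply, map_add]
      exact hu1.add hv1
    · refine (memLp_congr_ae ?_).2 (hu2.add hv2)
      have h0 : (𝓕 (u + v) : L2n n) = 𝓕 u + 𝓕 v := (Lp.fourierTransformₗᵢ _ ℂ).map_add u v
      unfold invRieszSymbol
      rw [h0]
      filter_upwards [Lp.coeFn_add (𝓕 u : L2n n) (𝓕 v)] with ξ hξ
      rw [hξ]
      simp [mul_add]
  smul_mem' := by
    rintro c u ⟨hu1, hu2⟩
    constructor
    · rw [← Lp.toTemperedDistributionCLM_apply, map_smul]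
      exact hu1.smul c
    · refine (memLp_congr_ae ?_).2 (hu2.const_mul c)
      have h0 : (𝓕 (c • u) : L2n n) = c • 𝓕 u := (Lp.fourierTransformₗᵢ _ ℂ).map_smul c u
      unfold invRieszSymbol
      rw [h0]
      filter_upwards [Lp.coeFn_smul c (𝓕 u : L2n n)] with ξ hξ
      rw [hξ]
      simp only [Pi.smul_apply, smul_eq_mul]
      ring

/-- The norm of `X_β`: `‖u‖² = ‖u‖_{H¹}² + ‖D^{-β}u‖_{L²}²`, `‖u‖_{H¹}² = ‖u‖² + ‖∇u‖²`. -/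
noncomputable def xNorm {n : ℕ} (β : ℝ) (u : L2n n) : ℝ :=
  Real.sqrt ((‖u‖ ^ 2 + gradNorm u ^ 2) + ‖invRiesz β u‖ ^ 2)

/-- `X_β ↪ L^r(ℝⁿ)` continuously. -/
def XEmbedsLp (n : ℕ) (β : ℝ) (r : ℝ≥0∞) : Prop :=
  ∃ C : ℝ, ∀ u ∈ XSpace n β,
    MemLp u r volume ∧ lpNorm u r volume ≤ C * xNorm β u

/-- `X_β ↪ L^r_loc(ℝⁿ)` compactly: the inclusion is well defined and continuous, and every
norm-bounded sequence of `X_β` has a subsequence that converges in `L^r_loc`, that is, in `L^r(K)`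
for every compact `K`. (`L^r_loc` is metrizable, so this is relative compactness of bounded sets.) -/
def XEmbedsCompactlyLpLoc (n : ℕ) (β : ℝ) (r : ℝ≥0∞) : Prop :=
  (∀ K : Set (EuclideanSpace ℝ (Fin n)), IsCompact K → ∃ C : ℝ, ∀ u ∈ XSpace n β,
    MemLp u r (volume.restrict K) ∧ lpNorm u r (volume.restrict K) ≤ C * xNorm β u) ∧
  ∀ u : ℕ → L2n n, (∀ k, u k ∈ XSpace n β) → (∃ M : ℝ, ∀ k, xNorm β (u k) ≤ M) →
    ∃ (φ : ℕ → ℕ) (v : EuclideanSpace ℝ (Fin n) → ℂ), StrictMono φ ∧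
      ∀ K : Set (EuclideanSpace ℝ (Fin n)), IsCompact K →
        MemLp v r (volume.restrict K) ∧
        Tendsto (fun k => eLpNorm (fun x => u (φ k) x - v x) r (volume.restrict K)) atTop (𝓝 0)

/-! The inequality is the product of two interpolations. By Plancherel, the squared norms of `u`,
`∇u` and `D^{-β}u` are integrals of `|û|²` with weights `1`, `|2πξ|²` and `|2πξ|^{-2β}`. The first
weight is a geometric mean of the other two, so Hölder gives `‖u‖ ≤ ‖∇u‖^{β/(β+1)}
‖D^{-β}u‖^{1/(β+1)}` (`norm_le_gradNorm_rpow_mul_invRiesz_rpow`). Applied to the factor `‖u‖^κ` of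
the classical Gagliardo–Nirenberg inequality, this gives the claim, with a constant independent of
`κ`.

Gagliardo–Nirenberg is the case `κ = 0`. For `C¹` functions of compact support it follows from one
endpoint bound per dimension, interpolated with `L²`: an `L^∞` bound for `n = 1`, bounds in
`L^{2(k+1)}` for `n = 2`, the Sobolev inequality for `n ≥ 3`. Cutoffs carry it to Schwartz
functions, and density with Fatou's lemma to `H¹`.

For compactness, a bounded sequence has a weakly convergent subsequence in `L²`. Restricted to a
frequency set of finite measure, the differences from the limit converge pointwise and boundedly,
hence in `L²(K)`; the gradient bound makes the remaining frequencies uniformly small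
(`exists_subseq_tendsto_eLpNorm_two`). Boundedness in some `L^s` with `s > q` upgrades `L²(K)` to
`L^q(K)`. -/

/-! ### Plancherel identities and interpolation of `L²` between `∇u` and `D^{-β}u` -/

theorem Lp_enorm_sq_eq_lintegral {n : ℕ} (u : L2n n) :
    ‖u‖ₑ ^ 2 = ∫⁻ x, ‖u x‖ₑ ^ 2 := by
  rw [Lp.enorm_def, ← ENNReal.rpow_natCast, eLpNorm_eq_lintegral_rpow_enorm_toReal (by simp) (by simp),
    ← ENNReal.rpow_mul]
  simp

/-- The Fourier transform of the distributional identity, tested against smooth functions of compact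
support, determines the locally integrable representatives almost everywhere. -/
theorem fourier_ae_eq_of_lineDeriv_eq {n : ℕ} {u w : L2n n} {m : EuclideanSpace ℝ (Fin n)}
    (h : ∂_{m} (u : 𝓢'(EuclideanSpace ℝ (Fin n), ℂ)) = (w : 𝓢'(EuclideanSpace ℝ (Fin n), ℂ))) :
    (𝓕 w : L2n n) =ᵐ[volume]
      fun ξ => (2 * Real.pi * Complex.I) * ((inner ℝ ξ m : ℝ) : ℂ) * (𝓕 u : L2n n) ξ := by
  have h1 := congrArg (fun f => 𝓕 f) h
  simp only [fourier_lineDerivOp_eq, Lp.fourier_toTemperedDistribution_eq] at h1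
  have hloc : ∀ f : L2n n, LocallyIntegrable f volume := fun f =>
    (Lp.memLp f).locallyIntegrable one_le_two
  refine ae_eq_of_integral_contDiff_smul_eq (hloc _) ?_ ?_
  · have := (locallyIntegrableOn_univ.2 (hloc (𝓕 u : L2n n))).continuousOn_mul
      (g := fun ξ => (2 * Real.pi * Complex.I) * ((inner ℝ ξ m : ℝ) : ℂ))
      (by fun_prop) isOpen_univ.isLocallyClosed
    exact locallyIntegrableOn_univ.1 this
  · intro g g_smooth g_cpt
    have hg₁ : HasCompactSupport (Complex.ofRealCLM ∘ g) := g_cpt.comp_left rfl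
    have hg₂ : ContDiff ℝ ((⊤ : ℕ∞) : WithTop ℕ∞) (Complex.ofRealCLM ∘ g) :=
      Complex.ofRealCLM.contDiff.comp g_smooth
    have h2 := DFunLike.congr_fun h1 (hg₁.toSchwartzMap hg₂)
    have ht : (fun x : EuclideanSpace ℝ (Fin n) => ((inner ℝ x m : ℝ) : ℂ)).HasTemperateGrowth := by
      fun_prop
    simp [smulLeftCLM_apply_apply, SchwartzMap.smulLeftCLM_apply_apply ht] at h2
    simp only [Complex.real_smul]
    rw [← h2, ← integral_const_mul]
    congr 1
    ext x
    ring

theorem weakPartial_fourier_ae {n : ℕ} (j : Fin n) {u : L2n n}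
    (hu : MemSobolev 1 2 (u : 𝓢'(EuclideanSpace ℝ (Fin n), ℂ))) :
    (𝓕 (weakPartial j u) : L2n n) =ᵐ[volume]
      fun ξ => (2 * Real.pi * Complex.I) * ((ξ j : ℝ) : ℂ) * (𝓕 u : L2n n) ξ := by
  simpa [EuclideanSpace.inner_single_right] using fourier_ae_eq_of_lineDeriv_eq (weakPartial_spec j hu)

theorem Lp_enorm_fourier {n : ℕ} (u : L2n n) : ‖(𝓕 u : L2n n)‖ₑ = ‖u‖ₑ := by
  rw [← ofReal_norm, Lp.norm_fourier_eq, ofReal_norm]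

theorem gradNorm_nonneg {n : ℕ} (u : L2n n) : 0 ≤ gradNorm u := Real.sqrt_nonneg _

theorem gradNorm_sq_eq_lintegral {n : ℕ} {u : L2n n}
    (hu : MemSobolev 1 2 (u : 𝓢'(EuclideanSpace ℝ (Fin n), ℂ))) :
    ENNReal.ofReal (gradNorm u) ^ 2 =
      ∫⁻ ξ : EuclideanSpace ℝ (Fin n),
        ENNReal.ofReal (2 * Real.pi * ‖ξ‖) ^ 2 * ‖(𝓕 u : L2n n) ξ‖ₑ ^ 2 := by
  have h1 : ∀ j : Fin n, ENNReal.ofReal (‖weakPartial j u‖ ^ 2) =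
      ∫⁻ ξ : EuclideanSpace ℝ (Fin n),
        ENNReal.ofReal ((2 * Real.pi) ^ 2 * ‖ξ j‖ ^ 2) * ‖(𝓕 u : L2n n) ξ‖ₑ ^ 2 := by
    intro j
    rw [ENNReal.ofReal_pow (norm_nonneg _), ofReal_norm, ← Lp_enorm_fourier, Lp_enorm_sq_eq_lintegral]
    refine lintegral_congr_ae ?_
    filter_upwards [weakPartial_fourier_ae j hu] with ξ hξ
    rw [hξ, enorm_mul, mul_pow, ← ofReal_norm, ← ENNReal.ofReal_pow (norm_nonneg _)]
    congr 2
    simp [mul_pow]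
  rw [gradNorm, ← ENNReal.ofReal_pow (Real.sqrt_nonneg _), Real.sq_sqrt (by positivity),
    ENNReal.ofReal_sum_of_nonneg (fun _ _ => by positivity)]
  simp_rw [h1]
  rw [← lintegral_finsetSum' _ (fun j _ => ?_)]
  · refine lintegral_congr fun ξ => ?_
    rw [← Finset.sum_mul, ← ENNReal.ofReal_sum_of_nonneg (fun _ _ => by positivity),
      ← Finset.mul_sum, ← EuclideanSpace.norm_sq_eq, ← mul_pow, ENNReal.ofReal_pow (by positivity)]
  · have := (Lp.aestronglyMeasurable (𝓕 u : L2n n)).enorm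
    exact (by fun_prop : Measurable fun ξ : EuclideanSpace ℝ (Fin n) =>
      ENNReal.ofReal ((2 * Real.pi) ^ 2 * ‖ξ j‖ ^ 2)).aemeasurable.mul (this.pow_const 2)

theorem invRiesz_sq_eq_lintegral {n : ℕ} {β : ℝ} {u : L2n n}
    (hu : MemLp (invRieszSymbol β u) 2 volume) :
    ‖invRiesz β u‖ₑ ^ 2 =
      ∫⁻ ξ : EuclideanSpace ℝ (Fin n),
        ENNReal.ofReal ((2 * Real.pi * ‖ξ‖) ^ (-β)) ^ 2 * ‖(𝓕 u : L2n n) ξ‖ₑ ^ 2 := by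
  rw [invRiesz, dif_pos hu, ← Lp_enorm_fourier, FourierTransform.fourier_fourierInv_eq,
    Lp_enorm_sq_eq_lintegral]
  refine lintegral_congr_ae ?_
  filter_upwards [hu.coeFn_toLp] with ξ hξ
  rw [hξ, invRieszSymbol, enorm_mul, mul_pow, ← ofReal_norm, Complex.norm_real, Real.norm_eq_abs,
    abs_of_nonneg (by positivity)]

theorem norm_le_gradNorm_rpow_mul_invRiesz_rpow {n : ℕ} (hn : 1 ≤ n) {β : ℝ} (hβ : 0 < β)
    {u : L2n n} (hu : u ∈ XSpace n β) :
    ‖u‖ ≤ gradNorm u ^ (β / (β + 1)) * ‖invRiesz β u‖ ^ (1 / (β + 1)) := by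
  obtain ⟨hu1, hu2⟩ := hu
  have : Nonempty (Fin n) := ⟨⟨0, hn⟩⟩
  have hm := (Lp.aestronglyMeasurable (𝓕 u : L2n n)).enorm
  have hp : 0 ≤ β / (β + 1) := by positivity
  have hq : 0 ≤ 1 / (β + 1) := by positivity
  have key : ‖u‖ₑ ^ 2 ≤ (ENNReal.ofReal (gradNorm u) ^ 2) ^ (β / (β + 1)) *
      (‖invRiesz β u‖ₑ ^ 2) ^ (1 / (β + 1)) := by
    rw [gradNorm_sq_eq_lintegral hu1, invRiesz_sq_eq_lintegral hu2, ← Lp_enorm_fourier,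
      Lp_enorm_sq_eq_lintegral]
    refine le_trans (le_of_eq (lintegral_congr_ae ?_)) (ENNReal.lintegral_mul_norm_pow_le
      (.mul (by fun_prop) (hm.pow_const 2)) (.mul (by fun_prop) (hm.pow_const 2)) hp hq
      (by field_simp))
    -- The two weights multiply to `1` only off the origin, since `0 ^ (-β) = 0`. The origin is a
    -- null set because `n ≥ 1`.
    have h0 : ∀ᵐ ξ : EuclideanSpace ℝ (Fin n), ξ ≠ 0 := by
      simp [ae_iff]
    filter_upwards [h0] with ξ hξ
    have hpos : 0 < 2 * Real.pi * ‖ξ‖ := by positivity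
    simp only [Pi.mul_apply]
    rw [ENNReal.mul_rpow_of_nonneg _ _ hp, ENNReal.mul_rpow_of_nonneg _ _ hq, mul_mul_mul_comm,
      ← ENNReal.rpow_add_of_nonneg _ _ hp hq]
    have h1 : β / (β + 1) + 1 / (β + 1) = 1 := by field_simp
    rw [h1, ENNReal.rpow_one, ← ENNReal.ofReal_pow (by positivity), ← ENNReal.ofReal_pow (by positivity),
      ENNReal.ofReal_rpow_of_nonneg (by positivity) hp, ENNReal.ofReal_rpow_of_nonneg (by positivity) hq,
      ← ENNReal.ofReal_mul (by positivity), ← Real.rpow_natCast, ← Real.rpow_natCast,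
      ← Real.rpow_mul hpos.le, ← Real.rpow_mul hpos.le, ← Real.rpow_mul hpos.le, ← Real.rpow_add hpos]
    have h2 : ((2 : ℕ) : ℝ) * (β / (β + 1)) + -β * (2 : ℕ) * (1 / (β + 1)) = 0 := by
      field_simp; ring
    rw [h2, Real.rpow_zero, ENNReal.ofReal_one, one_mul]
  have hg := gradNorm_nonneg u
  rw [← ofReal_norm, ← ofReal_norm, ← ENNReal.ofReal_pow hg, ← ENNReal.ofReal_pow (norm_nonneg _),
    ← ENNReal.ofReal_pow (norm_nonneg _), ENNReal.ofReal_rpow_of_nonneg (by positivity) hp,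
    ENNReal.ofReal_rpow_of_nonneg (by positivity) hq, ← ENNReal.ofReal_mul (by positivity),
    ENNReal.ofReal_le_ofReal_iff (by positivity)] at key
  refine le_of_sq_le_sq (key.trans_eq ?_) (by positivity)
  rw [mul_pow, ← Real.rpow_natCast (gradNorm u), ← Real.rpow_natCast (gradNorm u ^ _),
    ← Real.rpow_natCast ‖invRiesz β u‖, ← Real.rpow_natCast (‖invRiesz β u‖ ^ _),
    ← Real.rpow_mul hg, ← Real.rpow_mul hg, ← Real.rpow_mul (norm_nonneg _),
    ← Real.rpow_mul (norm_nonneg _), mul_comm _ (β / (β + 1)), mul_comm _ (1 / (β + 1))]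

/-! ### Approximation of `H¹` functions by Schwartz functions -/

theorem norm_sub_le_of_fourier_ae_le {n : ℕ} {a b c d : L2n n} {C : ℝ}
    (h : ∀ᵐ ξ : EuclideanSpace ℝ (Fin n),
      ‖(𝓕 a : L2n n) ξ - (𝓕 b : L2n n) ξ‖ ≤ C * ‖c ξ - d ξ‖) : ‖a - b‖ ≤ C * ‖c - d‖ := by
  have h1 : (𝓕 (a - b) : L2n n) = 𝓕 a - 𝓕 b := (Lp.fourierTransformₗᵢ _ ℂ).map_sub a b
  rw [← Lp.norm_fourier_eq (a - b), h1]
  refine Lp.norm_le_mul_norm_of_ae_le_mul ?_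
  filter_upwards [h, Lp.coeFn_sub (𝓕 a : L2n n) (𝓕 b), Lp.coeFn_sub c d] with ξ h1 h2 h3
  rw [h2, h3]
  exact h1

theorem memLp_one_add_norm_sq_rpow_mul_fourier {n : ℕ} {u : L2n n}
    (hu : MemSobolev 1 2 (u : 𝓢'(EuclideanSpace ℝ (Fin n), ℂ))) :
    MemLp (fun ξ : EuclideanSpace ℝ (Fin n) =>
      (((1 + ‖ξ‖ ^ 2) ^ (1 / 2 : ℝ) : ℝ) : ℂ) * (𝓕 u : L2n n) ξ) 2 volume := by
  have hm := Lp.aestronglyMeasurable (𝓕 u : L2n n)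
  refine ⟨.mul (Measurable.aestronglyMeasurable (by fun_prop)) hm, ?_⟩
  rw [eLpNorm_lt_top_iff_lintegral_rpow_enorm_lt_top (by simp) (by simp)]
  have h1 : ∫⁻ ξ, ‖(𝓕 u : L2n n) ξ‖ₑ ^ 2 +
      ENNReal.ofReal (2 * Real.pi * ‖ξ‖) ^ 2 * ‖(𝓕 u : L2n n) ξ‖ₑ ^ 2 < ∞ := by
    rw [lintegral_add_left' (hm.enorm.pow_const 2), ← gradNorm_sq_eq_lintegral hu,
      ← Lp_enorm_sq_eq_lintegral]
    exact ENNReal.add_lt_top.2 ⟨by simp, by simp⟩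
  refine lt_of_le_of_lt (lintegral_mono fun ξ => ?_) h1
  rw [← one_add_mul, enorm_mul, ENNReal.mul_rpow_of_nonneg _ _ (by simp)]
  simp only [ENNReal.toReal_ofNat, ENNReal.rpow_ofNat]
  gcongr
  rw [← ofReal_norm, Complex.norm_real, Real.norm_eq_abs, abs_of_nonneg (by positivity),
    ← ENNReal.ofReal_pow (by positivity), ← ENNReal.ofReal_pow (by positivity), ← ENNReal.ofReal_one,
    ← ENNReal.ofReal_add (by positivity) (by positivity), ← Real.rpow_natCast _ 2,
    ← Real.rpow_mul (by positivity)]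
  norm_num
  refine ENNReal.ofReal_le_ofReal ?_
  have : 1 ≤ 2 * Real.pi := by nlinarith [Real.pi_gt_three]
  have h2 : ‖ξ‖ ≤ 2 * Real.pi * ‖ξ‖ := le_mul_of_one_le_left (norm_nonneg _) this
  gcongr

/-- The function `h = (1 + |ξ|²)^{1/2} û` is in `L²`, so Schwartz functions `g k` converge to it
there. With `J = (1 + |ξ|²)^{-1/2}`, the inverse transforms of `J · g k` converge to `u` because
`|J| ≤ 1`, and their derivatives converge because `|ξ| |J| ≤ 1`. -/
theorem exists_schwartz_tendsto {n : ℕ} {u : L2n n}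
    (hu : MemSobolev 1 2 (u : 𝓢'(EuclideanSpace ℝ (Fin n), ℂ))) :
    ∃ φ : ℕ → 𝓢(EuclideanSpace ℝ (Fin n), ℂ),
      Tendsto (fun k => (φ k).toLp 2) atTop (𝓝 u) ∧
      ∀ j, Tendsto (fun k => (∂_{EuclideanSpace.single j (1 : ℝ)} (φ k)).toLp 2) atTop
        (𝓝 (weakPartial j u)) := by
  have hmem := memLp_one_add_norm_sq_rpow_mul_fourier hu
  set h : L2n n := hmem.toLp _ with hh
  have hd : DenseRange (SchwartzMap.toLpCLM ℂ (E := EuclideanSpace ℝ (Fin n)) ℂ 2 volume) :=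
    SchwartzMap.denseRange_toLpCLM ENNReal.ofNat_ne_top
  obtain ⟨x, hx, hxt⟩ := mem_closure_iff_seq_limit.1 (hd h)
  choose g hg using hx
  simp only [SchwartzMap.toLpCLM_apply] at hg
  set J : EuclideanSpace ℝ (Fin n) → ℂ := fun ξ => (((1 + ‖ξ‖ ^ 2) ^ (-(1 / 2) : ℝ) : ℝ) : ℂ) with hJ
  have ht : J.HasTemperateGrowth := by fun_prop
  have hJnorm : ∀ ξ, ‖J ξ‖ = (1 + ‖ξ‖ ^ 2) ^ (-(1 / 2) : ℝ) := fun ξ => by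
    rw [hJ, Complex.norm_real, Real.norm_eq_abs, abs_of_nonneg (by positivity)]
  have hJ1 : ∀ ξ, ‖J ξ‖ ≤ 1 := fun ξ => by
    rw [hJnorm]
    exact Real.rpow_le_one_of_one_le_of_nonpos (by simp) (by norm_num)
  have hJ2 : ∀ ξ, ‖ξ‖ * ‖J ξ‖ ≤ 1 := fun ξ => by
    rw [hJnorm, Real.rpow_neg (by positivity), ← Real.sqrt_eq_rpow]
    refine mul_inv_le_one_of_le₀ ?_ (by positivity)
    exact Real.le_sqrt_of_sq_le (by simp)
  have hû : ∀ᵐ ξ, (𝓕 u : L2n n) ξ = J ξ * h ξ := by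
    filter_upwards [hmem.coeFn_toLp] with ξ hξ
    rw [hh, hξ, hJ, ← mul_assoc, ← Complex.ofReal_mul, ← Real.rpow_add (by positivity)]
    simp
  have hφ : ∀ k, (𝓕 ((𝓕⁻ (SchwartzMap.smulLeftCLM ℂ J (g k))).toLp 2) : L2n n) =ᵐ[volume]
      fun ξ => J ξ * x k ξ := by
    intro k
    rw [SchwartzMap.toLp_fourier_eq, FourierTransform.fourier_fourierInv_eq, ← hg]
    filter_upwards [SchwartzMap.coeFn_toLp (SchwartzMap.smulLeftCLM ℂ J (g k)) 2 volume,
      SchwartzMap.coeFn_toLp (g k) 2 volume] with ξ h1 h2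
    rw [h1, h2, SchwartzMap.smulLeftCLM_apply_apply ht, smul_eq_mul]
  refine ⟨fun k => 𝓕⁻ (SchwartzMap.smulLeftCLM ℂ J (g k)), ?_, fun j => ?_⟩
  · rw [tendsto_iff_norm_sub_tendsto_zero] at hxt ⊢
    refine squeeze_zero (fun _ => norm_nonneg _) (fun k => ?_) hxt
    rw [← one_mul ‖x k - h‖]
    refine norm_sub_le_of_fourier_ae_le ?_
    filter_upwards [hû, hφ k] with ξ h1 h2
    rw [h1, h2, ← mul_sub, norm_mul]
    gcongr
    exact hJ1 ξ
  · have hxt' := (tendsto_iff_norm_sub_tendsto_zero.1 hxt).const_mul (2 * Real.pi)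
    rw [mul_zero] at hxt'
    rw [tendsto_iff_norm_sub_tendsto_zero]
    refine squeeze_zero (fun _ => norm_nonneg _) (fun k => ?_) hxt'
    refine norm_sub_le_of_fourier_ae_le ?_
    have hdist : ∂_{EuclideanSpace.single j (1 : ℝ)}
        (((𝓕⁻ (SchwartzMap.smulLeftCLM ℂ J (g k))).toLp 2 : L2n n) :
          𝓢'(EuclideanSpace ℝ (Fin n), ℂ)) =
        (((∂_{EuclideanSpace.single j (1 : ℝ)}
          (𝓕⁻ (SchwartzMap.smulLeftCLM ℂ J (g k)))).toLp 2 : L2n n) :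
          𝓢'(EuclideanSpace ℝ (Fin n), ℂ)) := by
      rw [Lp.toTemperedDistribution_toLp_eq, Lp.toTemperedDistribution_toLp_eq,
        lineDerivOp_toTemperedDistributionCLM_eq]
    filter_upwards [hû, hφ k, fourier_ae_eq_of_lineDeriv_eq hdist, weakPartial_fourier_ae j hu]
      with ξ h1 h2 h3 h4
    rw [h3, h4, h1, h2]
    have e1 : (inner ℝ ξ (EuclideanSpace.single j (1 : ℝ)) : ℝ) = ξ j := by
      simp [EuclideanSpace.inner_single_right]
    rw [e1, ← mul_sub, ← mul_sub, norm_mul, norm_mul (J ξ), ← mul_assoc]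
    refine mul_le_mul_of_nonneg_right ?_ (norm_nonneg _)
    have e2 : ‖(2 * (Real.pi : ℂ) * Complex.I) * ((ξ j : ℝ) : ℂ)‖ = 2 * Real.pi * ‖ξ j‖ := by
      simp [abs_of_pos Real.pi_pos]
    rw [e2, mul_assoc (2 * Real.pi)]
    exact mul_le_of_le_one_right (by positivity)
      ((mul_le_mul_of_nonneg_right (PiLp.norm_apply_le ξ j) (norm_nonneg _)).trans (hJ2 ξ))

/-- By Cauchy–Schwarz the operator norm of the derivative is at most the Euclidean norm of the
vector of partial derivatives. This links `fderiv`, used in the Sobolev estimates, to `gradNorm`. -/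
theorem eLpNorm_fderiv_schwartz_le {n : ℕ} (φ : 𝓢(EuclideanSpace ℝ (Fin n), ℂ)) :
    eLpNorm (fderiv ℝ φ) 2 volume ≤ ENNReal.ofReal (Real.sqrt (∑ j : Fin n,
      ‖(∂_{EuclideanSpace.single j (1 : ℝ)} φ : 𝓢(EuclideanSpace ℝ (Fin n), ℂ)).toLp 2 volume‖ ^ 2)) := by
  have hfd : ∀ x, ‖fderiv ℝ φ x‖ ^ 2 ≤
      ∑ j : Fin n, ‖(∂_{EuclideanSpace.single j (1 : ℝ)} φ : 𝓢(EuclideanSpace ℝ (Fin n), ℂ)) x‖ ^ 2 := by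
    intro x
    rw [← Real.le_sqrt (norm_nonneg _) (by positivity)]
    refine ContinuousLinearMap.opNorm_le_bound _ (Real.sqrt_nonneg _) fun v => ?_
    have hv : v = ∑ j : Fin n, v j • EuclideanSpace.single j (1 : ℝ) := by
      ext i
      simp [Finset.sum_apply, Pi.single_apply]
    have h1 : fderiv ℝ φ x v = ∑ j : Fin n, (v j) • (∂_{EuclideanSpace.single j (1 : ℝ)} φ : 𝓢(EuclideanSpace ℝ (Fin n), ℂ)) x := by
      conv_lhs => rw [hv]
      simp [SchwartzMap.lineDerivOp_apply_eq_fderiv]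
    rw [h1, EuclideanSpace.norm_eq, mul_comm]
    refine (norm_sum_le _ _).trans ?_
    simp_rw [norm_smul]
    exact Real.sum_mul_le_sqrt_mul_sqrt _ _ _
  rw [← ENNReal.rpow_le_rpow_iff (z := 2) (by norm_num), ENNReal.ofReal_rpow_of_nonneg
    (Real.sqrt_nonneg _) (by norm_num), Real.rpow_ofNat, Real.sq_sqrt (by positivity),
    eLpNorm_eq_lintegral_rpow_enorm_toReal (by simp) (by simp), ← ENNReal.rpow_mul,
    ENNReal.ofReal_sum_of_nonneg (fun _ _ => by positivity)]
  simp_rw [ENNReal.ofReal_pow (norm_nonneg _), ofReal_norm, Lp_enorm_sq_eq_lintegral]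
  simp only [ENNReal.toReal_ofNat, ENNReal.rpow_ofNat, one_div, ne_eq, OfNat.ofNat_ne_zero,
    not_false_eq_true, inv_mul_cancel₀, ENNReal.rpow_one]
  rw [← lintegral_finsetSum' _ (fun j _ => (Lp.aestronglyMeasurable _).enorm.pow_const 2)]
  have h2 : ∀ᵐ x : EuclideanSpace ℝ (Fin n), ∀ j : Fin n,
      ((∂_{EuclideanSpace.single j (1 : ℝ)} φ : 𝓢(EuclideanSpace ℝ (Fin n), ℂ)).toLp 2 volume : L2n n) x =
        (∂_{EuclideanSpace.single j (1 : ℝ)} φ : 𝓢(EuclideanSpace ℝ (Fin n), ℂ)) x :=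
    ae_all_iff.2 fun j => SchwartzMap.coeFn_toLp
      (∂_{EuclideanSpace.single j (1 : ℝ)} φ : 𝓢(EuclideanSpace ℝ (Fin n), ℂ)) 2 volume
  refine lintegral_mono_ae ?_
  filter_upwards [h2] with x hx
  simp_rw [hx, ← ofReal_norm, ← ENNReal.ofReal_pow (norm_nonneg _)]
  rw [← ENNReal.ofReal_sum_of_nonneg (fun _ _ => by positivity)]
  exact ENNReal.ofReal_le_ofReal (hfd x)

/-! ### Gagliardo–Nirenberg for `C¹` functions of compact support -/

/-- Hölder for `|f| = |f|^{1-t} |f|^t` with exponents `p/(1-t)` and `s/t`; `t = 1` is trivial and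
kept apart to avoid dividing by zero. -/
theorem eLpNorm_le_eLpNorm_rpow_mul_eLpNorm_rpow {α E : Type*} [MeasurableSpace α] {μ : Measure α}
    [NormedAddCommGroup E] {f : α → E} (hf : AEStronglyMeasurable f μ) {p s r : ℝ≥0∞} {t : ℝ}
    (ht0 : 0 < t) (ht1 : t ≤ 1) (h : r⁻¹ = ENNReal.ofReal (1 - t) * p⁻¹ + ENNReal.ofReal t * s⁻¹) :
    eLpNorm f r μ ≤ eLpNorm f p μ ^ (1 - t) * eLpNorm f s μ ^ t := by
  rcases ht1.eq_or_lt with rfl | ht1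
  · simp only [sub_self, ENNReal.ofReal_zero, zero_mul, ENNReal.ofReal_one, one_mul, zero_add,
      inv_inj] at h
    simp [h]
  have ht1' : 0 < 1 - t := sub_pos.2 ht1
  have key : ∀ (q : ℝ≥0∞) (a : ℝ), 0 < a →
      eLpNorm (fun x => ‖f x‖ ^ a) (q / ENNReal.ofReal a) μ = eLpNorm f q μ ^ a := fun q a ha => by
    rw [eLpNorm_norm_rpow f ha, ENNReal.div_mul_cancel (by simpa using ha) (by simp)]
  have hinv : ∀ (q : ℝ≥0∞) (a : ℝ), 0 < a →
      (q / ENNReal.ofReal a)⁻¹ = ENNReal.ofReal a * q⁻¹ := fun q a ha => by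
    rw [ENNReal.inv_div (by simp) (by simp [ha]), div_eq_mul_inv]
  have : (p / ENNReal.ofReal (1 - t)).HolderTriple (s / ENNReal.ofReal t) r :=
    ⟨by rw [hinv _ _ ht1', hinv _ _ ht0, h]⟩
  have hm : ∀ a : ℝ, 0 ≤ a → AEStronglyMeasurable (fun x => ‖f x‖ ^ a) μ := fun a ha =>
    (Real.continuous_rpow_const ha).comp_aestronglyMeasurable hf.norm
  have h1 := eLpNorm_smul_le_mul_eLpNorm (p := p / ENNReal.ofReal (1 - t)) (q := s / ENNReal.ofReal t)
    (r := r) (hm t ht0.le) (hm (1 - t) ht1'.le)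
  rw [key _ _ ht1', key _ _ ht0] at h1
  refine le_trans (le_of_eq ?_) h1
  refine eLpNorm_congr_norm_ae (Eventually.of_forall fun x => ?_)
  simp only [Pi.smul_apply', smul_eq_mul]
  rw [← Real.rpow_add_of_nonneg (norm_nonneg _) ht1'.le ht0.le]
  simp

/-- Reduces each dimension to a single endpoint `s`: interpolation with `L²` multiplies the gradient
exponent `σ` by `t`. -/
theorem eLpNorm_le_of_eLpNorm_le_rpow_mul_rpow {α E : Type*} [MeasurableSpace α] {μ : Measure α}
    [NormedAddCommGroup E] {f : α → E} (hf : AEStronglyMeasurable f μ) {s r C G : ℝ≥0∞} {t σ θ : ℝ}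
    (ht0 : 0 < t) (ht1 : t ≤ 1) (hσ1 : σ ≤ 1) (hθ : t * σ = θ)
    (h : r⁻¹ = ENNReal.ofReal (1 - t) * 2⁻¹ + ENNReal.ofReal t * s⁻¹)
    (hC : eLpNorm f s μ ≤ C * eLpNorm f 2 μ ^ (1 - σ) * G ^ σ) :
    eLpNorm f r μ ≤ C ^ t * eLpNorm f 2 μ ^ (1 - θ) * G ^ θ := by
  refine (eLpNorm_le_eLpNorm_rpow_mul_eLpNorm_rpow hf ht0 ht1 h).trans ?_
  grw [hC]
  rw [ENNReal.mul_rpow_of_nonneg _ _ ht0.le, ENNReal.mul_rpow_of_nonneg _ _ ht0.le,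
    ← ENNReal.rpow_mul, ← ENNReal.rpow_mul, mul_comm σ, hθ]
  have h2 : 1 - θ = (1 - t) + (1 - σ) * t := by rw [← hθ]; ring
  rw [h2, ENNReal.rpow_add_of_nonneg _ _ (by linarith) (by nlinarith)]
  exact le_of_eq (by ring)

theorem lintegral_enorm_mul_enorm_le {α E F : Type*} [MeasurableSpace α] {μ : Measure α}
    [NormedAddCommGroup E] [NormedAddCommGroup F] {f : α → E} {g : α → F}
    (hf : AEStronglyMeasurable f μ) (hg : AEStronglyMeasurable g μ) :
    ∫⁻ x, ‖f x‖ₑ * ‖g x‖ₑ ∂μ ≤ eLpNorm f 2 μ * eLpNorm g 2 μ := by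
  have := ENNReal.lintegral_mul_le_Lp_mul_Lq μ Real.HolderConjugate.two_two hf.enorm hg.enorm
  simpa [eLpNorm_eq_lintegral_rpow_enorm_toReal] using this

/-- On the line, `|u(x)|²` is at most the integral of `|(u²)'| = 2|u||u'|` over a half-line;
Cauchy–Schwarz finishes. The isometry `e` transports this from `ℝ` to the one-dimensional Euclidean
space. -/
theorem enorm_sq_le_of_contDiff_of_hasCompactSupport {u : EuclideanSpace ℝ (Fin 1) → ℂ}
    (hu : ContDiff ℝ 1 u) (hc : HasCompactSupport u) (x : EuclideanSpace ℝ (Fin 1)) :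
    ‖u x‖ₑ ^ 2 ≤ 2 * (eLpNorm u 2 volume * eLpNorm (fderiv ℝ u) 2 volume) := by
  let e : ℝ ≃ₗᵢ[ℝ] EuclideanSpace ℝ (Fin 1) := (OrthonormalBasis.singleton (Fin 1) ℝ).repr
  have hec : ContDiff ℝ 1 e := e.toContinuousLinearEquiv.contDiff
  have hue : ContDiff ℝ 1 (fun s => u (e s)) := hu.comp hec
  have hcs : HasCompactSupport (fun s => u (e s) ^ 2) := by
    have h1 : HasCompactSupport (u ∘ e) := hc.comp_homeomorph e.toHomeomorph
    exact h1.comp_left (g := fun z : ℂ => z ^ 2) (by simp)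
  have h0 := hcs.enorm_le_lintegral_Ici_deriv (hue.pow 2) (e.symm x)
  simp only [LinearIsometryEquiv.apply_symm_apply, enorm_pow] at h0
  have hfd : Continuous (fderiv ℝ u) := hu.continuous_fderiv (by simp)
  refine (h0.trans (setLIntegral_le_lintegral _ _)).trans ?_
  have h1 : ∀ s, ‖deriv (fun s => u (e s) ^ 2) s‖ₑ ≤
      (fun y => 2 * (‖u y‖ₑ * ‖fderiv ℝ u y‖ₑ)) (e s) := by
    intro s
    have hd : HasDerivAt (fun s => u (e s)) (fderiv ℝ u (e s) (e 1)) s := by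
      have := ((hu.differentiable (by simp)) (e s)).hasFDerivAt.comp s
        e.toContinuousLinearEquiv.hasFDerivAt
      have h2 := this.hasDerivAt
      simp only [ContinuousLinearMap.comp_apply] at h2
      exact h2
    have hd2 : HasDerivAt (fun s => u (e s) ^ 2) _ s := hd.fun_pow 2
    rw [hd2.deriv]
    simp only [Nat.cast_ofNat, Nat.add_one_sub_one, pow_one, enorm_mul, mul_assoc]
    gcongr
    · simp [← ofReal_norm]
    · refine (ContinuousLinearMap.le_opENorm _ _).trans ?_
      simp [← ofReal_norm]
  have hm : Measurable fun y => 2 * (‖u y‖ₑ * ‖fderiv ℝ u y‖ₑ) :=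
    ((hu.continuous.enorm.measurable).mul hfd.enorm.measurable).const_mul 2
  refine (lintegral_mono h1).trans ?_
  have hm' : Measurable fun y => ‖u y‖ₑ * ‖fderiv ℝ u y‖ₑ :=
    (hu.continuous.enorm.measurable).mul hfd.enorm.measurable
  rw [e.measurePreserving.lintegral_comp hm, lintegral_const_mul _ hm']
  gcongr
  exact lintegral_enorm_mul_enorm_le hu.continuous.aestronglyMeasurable hfd.aestronglyMeasurable

theorem eLpNorm_top_le_of_contDiff_of_hasCompactSupport {u : EuclideanSpace ℝ (Fin 1) → ℂ}
    (hu : ContDiff ℝ 1 u) (hc : HasCompactSupport u) :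
    eLpNorm u ∞ volume ≤ 2 ^ (1 / 2 : ℝ) * eLpNorm u 2 volume ^ (1 / 2 : ℝ) *
      eLpNorm (fderiv ℝ u) 2 volume ^ (1 / 2 : ℝ) := by
  rw [eLpNorm_exponent_top]
  refine essSup_le_of_ae_le _ (Eventually.of_forall fun x => ?_)
  have := ENNReal.rpow_le_rpow (enorm_sq_le_of_contDiff_of_hasCompactSupport hu hc x)
    (by norm_num : (0 : ℝ) ≤ 1 / 2)
  rw [← ENNReal.rpow_natCast, ← ENNReal.rpow_mul, ENNReal.mul_rpow_of_nonneg _ _ (by norm_num),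
    ENNReal.mul_rpow_of_nonneg _ _ (by norm_num), ← mul_assoc] at this
  simpa using this

/-- Induction on `k`: the planar Sobolev inequality `‖f‖₂ ≤ D ‖∇f‖₁` is applied to `f = u^{k+2}`,
and Cauchy–Schwarz on `∇f = (k+2) u^{k+1} ∇u` leaves one more factor `‖∇u‖₂`. -/
theorem exists_eLpNorm_pow_le_of_contDiff_of_hasCompactSupport (k : ℕ) :
    ∃ C : ℝ≥0∞, C ≠ ∞ ∧ ∀ u : EuclideanSpace ℝ (Fin 2) → ℂ, ContDiff ℝ 1 u → HasCompactSupport u →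
      eLpNorm (fun x => u x ^ (k + 1)) 2 volume ≤
        C * eLpNorm u 2 volume * eLpNorm (fderiv ℝ u) 2 volume ^ k := by
  induction k with
  | zero => exact ⟨1, by simp, fun u hu hc => by simp⟩
  | succ k ih =>
    obtain ⟨C, hC, h⟩ := ih
    set D : NNReal := eLpNormLESNormFDerivOneConst (volume : Measure (EuclideanSpace ℝ (Fin 2)))
      ((2 : NNReal) : ℝ) with hD
    refine ⟨D * (k + 2) * C, by finiteness, fun u hu hc => ?_⟩
    have hfd : Continuous (fderiv ℝ u) := hu.continuous_fderiv (by simp)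
    have h1 := eLpNorm_le_eLpNorm_fderiv_one (volume : Measure (EuclideanSpace ℝ (Fin 2)))
      (hu.pow (k + 2)) (hc.comp_left (g := fun z : ℂ => z ^ (k + 2)) (by simp)) (p := 2)
      (by rw [NNReal.holderConjugate_iff]
          simp only [finrank_euclideanSpace, Fintype.card_fin, Nat.cast_ofNat]
          exact ⟨by norm_num, by rw [← two_mul, mul_inv_cancel₀ (by norm_num)]⟩)
    rw [← hD] at h1
    refine h1.trans ?_
    have h2 : eLpNorm (fderiv ℝ (fun x => u x ^ (k + 2))) 1 volume ≤ (k + 2) *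
        (eLpNorm (fun x => u x ^ (k + 1)) 2 volume * eLpNorm (fderiv ℝ u) 2 volume) := by
      rw [eLpNorm_one_eq_lintegral_enorm]
      have hk : Continuous fun x => u x ^ (k + 1) := hu.continuous.pow (k + 1)
      grw [← lintegral_enorm_mul_enorm_le hk.aestronglyMeasurable hfd.aestronglyMeasurable]
      have hm : Measurable fun x => ‖u x ^ (k + 1)‖ₑ * ‖fderiv ℝ u x‖ₑ :=
        hk.enorm.measurable.mul hfd.enorm.measurable
      rw [← lintegral_const_mul _ hm]
      refine lintegral_mono fun x => ?_
      have hd : HasFDerivAt (fun x => u x ^ (k + 2)) _ x :=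
        HasFDerivAt.pow ((hu.differentiable (by simp)) x).hasFDerivAt (k + 2)
      rw [hd.fderiv, enorm_smul, ← mul_assoc]
      gcongr
      simp only [Nat.add_succ_sub_one, nsmul_eq_mul, enorm_mul]
      gcongr
      rw [← ofReal_norm, Complex.norm_natCast, ENNReal.ofReal_natCast]
      push_cast
      exact le_rfl
    grw [h2, h u hu hc]
    exact le_of_eq (by ring)

theorem inv_ofReal_eq_interp {r s t : ℝ} (hr : 0 < r) (hs : 0 < s) (ht0 : 0 ≤ t) (ht1 : t ≤ 1)
    (h : r⁻¹ = (1 - t) * 2⁻¹ + t * s⁻¹) :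
    (ENNReal.ofReal r)⁻¹ = ENNReal.ofReal (1 - t) * 2⁻¹ + ENNReal.ofReal t * (ENNReal.ofReal s)⁻¹ := by
  have h2 : (2 : ℝ≥0∞) = ENNReal.ofReal 2 := by simp
  have h1 := sub_nonneg.2 ht1
  rw [h2, ← ENNReal.ofReal_inv_of_pos hr, ← ENNReal.ofReal_inv_of_pos hs,
    ← ENNReal.ofReal_inv_of_pos two_pos, ← ENNReal.ofReal_mul h1, ← ENNReal.ofReal_mul ht0,
    ← ENNReal.ofReal_add (by positivity) (by positivity), h]

theorem exists_eLpNorm_le_of_contDiff_of_hasCompactSupport {n : ℕ} (hn : 1 ≤ n) {p : ℝ} (hp : 0 < p)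
    (hpn : 2 < n → p ≤ 4 / ((n : ℝ) - 2)) :
    ∃ C : ℝ≥0∞, C ≠ ∞ ∧ ∀ u : EuclideanSpace ℝ (Fin n) → ℂ, ContDiff ℝ 1 u → HasCompactSupport u →
      eLpNorm u (ENNReal.ofReal (p + 2)) volume ≤
        C * eLpNorm u 2 volume ^ (1 - (n : ℝ) * p / (2 * (p + 2))) *
          eLpNorm (fderiv ℝ u) 2 volume ^ ((n : ℝ) * p / (2 * (p + 2))) := by
  have hp2 : 0 < p + 2 := by linarith
  obtain rfl | rfl | hn3 : n = 1 ∨ n = 2 ∨ 2 < n := by omega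
  · have ht1 : p / (p + 2) ≤ 1 := (div_le_one hp2).2 (by linarith)
    refine ⟨(2 ^ (1 / 2 : ℝ)) ^ (p / (p + 2)), by
      refine ENNReal.rpow_ne_top_of_nonneg (by positivity) ?_
      exact ENNReal.rpow_ne_top_of_nonneg (by norm_num) (by simp), fun u hu hc => ?_⟩
    refine eLpNorm_le_of_eLpNorm_le_rpow_mul_rpow (s := ∞) (t := p / (p + 2)) (σ := 1 / 2)
      hu.continuous.aestronglyMeasurable (by positivity) ht1 (by norm_num)
      (by field_simp; simp) ?_ ?_
    · have := inv_ofReal_eq_interp hp2 one_pos (t := 0) le_rfl zero_le_one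
      rw [ENNReal.inv_top, mul_zero, add_zero, ← ENNReal.ofReal_inv_of_pos hp2,
        (by simp : (2 : ℝ≥0∞) = ENNReal.ofReal 2), ← ENNReal.ofReal_inv_of_pos two_pos,
        ← ENNReal.ofReal_mul (sub_nonneg.2 ht1)]
      congr 1
      field_simp
      ring
    · have := eLpNorm_top_le_of_contDiff_of_hasCompactSupport hu hc
      norm_num at this ⊢
      exact this
  -- This `k` gives `p + 2 ≤ 2(k + 1)`, so `p + 2` lies between `2` and the endpoint exponent.
  · obtain ⟨k, hk⟩ : ∃ k : ℕ, k = ⌈p / 2⌉₊ := ⟨_, rfl⟩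
    have hk0 : 0 < k := hk ▸ Nat.ceil_pos.2 (by positivity)
    have hk0' : (0 : ℝ) < k := by exact_mod_cast hk0
    have hkp : p / 2 ≤ k := hk ▸ Nat.le_ceil _
    obtain ⟨C, hC, h⟩ := exists_eLpNorm_pow_le_of_contDiff_of_hasCompactSupport k
    have ht1 : p / (p + 2) * ((k + 1) / k) ≤ 1 := by
      rw [div_mul_div_comm, div_le_one (by positivity)]
      nlinarith
    refine ⟨(C ^ ((k : ℝ) + 1)⁻¹) ^ (p / (p + 2) * ((k + 1) / k)), by
      refine ENNReal.rpow_ne_top_of_nonneg (by positivity) ?_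
      exact ENNReal.rpow_ne_top_of_nonneg (by positivity) hC, fun u hu hc => ?_⟩
    refine eLpNorm_le_of_eLpNorm_le_rpow_mul_rpow (s := ENNReal.ofReal (2 * (k + 1)))
      (t := p / (p + 2) * ((k + 1) / k)) (σ := k / (k + 1))
      hu.continuous.aestronglyMeasurable (by positivity) ht1
      ((div_le_one (by positivity)).2 (by linarith)) (by push_cast; field_simp)
      (inv_ofReal_eq_interp hp2 (by positivity) (by positivity) ht1 ?_) ?_
    · field_simp
      ring
    · have h1 := h u hu hc
      have h2 := eLpNorm_norm_rpow (p := 2) (μ := volume) u (q := (k : ℝ) + 1) (by positivity)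
      have h3 : eLpNorm (fun x => u x ^ (k + 1)) 2 volume =
          eLpNorm (fun x => ‖u x‖ ^ ((k : ℝ) + 1)) 2 volume := by
        refine eLpNorm_congr_norm_ae (Eventually.of_forall fun x => ?_)
        rw [norm_pow, ← Real.rpow_natCast, Real.norm_of_nonneg (by positivity)]
        push_cast
        rfl
      rw [h3, h2] at h1
      have h4 := ENNReal.rpow_le_rpow h1 (by positivity : (0 : ℝ) ≤ ((k : ℝ) + 1)⁻¹)
      rw [← ENNReal.rpow_mul, mul_inv_cancel₀ (by positivity), ENNReal.rpow_one,
        ENNReal.mul_rpow_of_nonneg _ _ (by positivity), ENNReal.mul_rpow_of_nonneg _ _ (by positivity),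
        ← ENNReal.rpow_natCast, ← ENNReal.rpow_mul] at h4
      have e1 : 1 - (k : ℝ) / (k + 1) = ((k : ℝ) + 1)⁻¹ := by field_simp; ring
      have e2 : ENNReal.ofReal (2 * ((k : ℝ) + 1)) = 2 * ENNReal.ofReal ((k : ℝ) + 1) := by
        rw [ENNReal.ofReal_mul two_pos.le]; simp
      rw [e1, e2, div_eq_mul_inv]
      exact h4
  · have hn3' : (2 : ℝ) < n := by exact_mod_cast hn3
    have hn2 : (0 : ℝ) < (n : ℝ) - 2 := by linarith
    have hpn := hpn hn3
    rw [le_div_iff₀ hn2] at hpn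
    -- Equivalent to `p (n - 2) ≤ 4`: this is where the upper bound on `p` enters.
    have ht1 : (n : ℝ) * p / (2 * (p + 2)) ≤ 1 := (div_le_one (by positivity)).2 (by nlinarith)
    set D := SNormLESNormFDerivOfEqConst ℂ (volume : Measure (EuclideanSpace ℝ (Fin n)))
      ((2 : NNReal) : ℝ) with hD
    refine ⟨(D : ℝ≥0∞) ^ ((n : ℝ) * p / (2 * (p + 2))),
      ENNReal.rpow_ne_top_of_nonneg (by positivity) (by simp), fun u hu hc => ?_⟩
    refine eLpNorm_le_of_eLpNorm_le_rpow_mul_rpow (s := ENNReal.ofReal (2 * n / (n - 2)))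
      (t := (n : ℝ) * p / (2 * (p + 2))) (σ := 1) hu.continuous.aestronglyMeasurable (by positivity)
      ht1 le_rfl (by ring) (inv_ofReal_eq_interp hp2 (by positivity) (by positivity) ht1 ?_) ?_
    · field_simp
      ring
    · have := eLpNorm_le_eLpNorm_fderiv_of_eq (volume : Measure (EuclideanSpace ℝ (Fin n))) hu hc
        (p := 2) (p' := (2 * (n : ℝ) / (n - 2)).toNNReal) one_le_two
        (by simp only [finrank_euclideanSpace, Fintype.card_fin]; omega)
        (by
          rw [Real.coe_toNNReal _ (by positivity)]
          simp only [finrank_euclideanSpace, Fintype.card_fin, NNReal.coe_ofNat, NNReal.coe_inv]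
          field_simp)
      rw [← hD] at this
      simpa [ENNReal.ofReal] using this

/-! ### From compact support to `H¹` -/

theorem eLpNorm_le_of_tendsto_ae {α E : Type*} [MeasurableSpace α] {μ : Measure α}
    [NormedAddCommGroup E] {f : ℕ → α → E} {g : α → E} {r a : ℝ≥0∞} {b : ℕ → ℝ≥0∞}
    (hf : ∀ k, AEStronglyMeasurable (f k) μ)
    (hfg : ∀ᵐ x ∂μ, Tendsto (fun k => f k x) atTop (𝓝 (g x)))
    (hb : ∀ k, eLpNorm (f k) r μ ≤ b k) (hba : Tendsto b atTop (𝓝 a)) : eLpNorm g r μ ≤ a :=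
  (Lp.eLpNorm_lim_le_liminf_eLpNorm hf g hfg).trans
    ((liminf_le_liminf (Eventually.of_forall hb)).trans hba.liminf_eq.le)

theorem norm_fderiv_smul_le {E : Type*} [NormedAddCommGroup E] [NormedSpace ℝ E] {χ : E → ℝ}
    {f : E → ℂ} {x : E} (hχ : DifferentiableAt ℝ χ x) (hf : DifferentiableAt ℝ f x) :
    ‖fderiv ℝ (fun y => χ y • f y) x‖ ≤ ‖χ x‖ * ‖fderiv ℝ f x‖ + ‖fderiv ℝ χ x‖ * ‖f x‖ := by
  rw [fderiv_fun_smul hχ hf]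
  refine norm_add_le_of_le ?_ ?_
  · rw [norm_smul]
  · rw [ContinuousLinearMap.norm_smulRight_apply]

theorem exists_contDiff_cutoff (n : ℕ) : ∃ χ : EuclideanSpace ℝ (Fin n) → ℝ, ContDiff ℝ 1 χ ∧
    HasCompactSupport χ ∧ χ 0 = 1 ∧ ∀ x, ‖χ x‖ ≤ 1 := by
  let χ : ContDiffBump (0 : EuclideanSpace ℝ (Fin n)) := ⟨1, 2, one_pos, one_lt_two⟩
  exact ⟨χ, χ.contDiff, χ.hasCompactSupport, χ.one_of_mem_closedBall (by simp [χ]), fun x => by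
    rw [Real.norm_of_nonneg χ.nonneg]; exact χ.le_one⟩

/-- Truncation by `χ(x/(k+1))` does not increase the `L²` norm and adds at most `B/(k+1) · ‖φ‖₂` to
the gradient norm. Fatou's lemma handles the left-hand side. -/
theorem eLpNorm_schwartz_le_of_forall_contDiff {n : ℕ} {r C : ℝ≥0∞} (hC : C ≠ ∞) {a b : ℝ}
    (ha : 0 ≤ a) (hb : 0 ≤ b)
    (h : ∀ u : EuclideanSpace ℝ (Fin n) → ℂ, ContDiff ℝ 1 u → HasCompactSupport u →
      eLpNorm u r volume ≤ C * eLpNorm u 2 volume ^ a * eLpNorm (fderiv ℝ u) 2 volume ^ b)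
    (φ : 𝓢(EuclideanSpace ℝ (Fin n), ℂ)) :
    eLpNorm φ r volume ≤ C * eLpNorm φ 2 volume ^ a * eLpNorm (fderiv ℝ φ) 2 volume ^ b := by
  obtain ⟨χ, hχ, hχc, hχ0, hχ1⟩ := exists_contDiff_cutoff n
  obtain ⟨B, hB⟩ := (hχc.fderiv (𝕜 := ℝ)).exists_bound_of_continuous
    (hχ.continuous_fderiv (by simp))
  have hB0 : 0 ≤ B := (norm_nonneg _).trans (hB 0)
  let R : ℕ → ℝ := fun k => ((k : ℝ) + 1)⁻¹
  have hR : ∀ k, 0 < R k := fun k => by positivity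
  have hR0 : Tendsto R atTop (𝓝 0) := by
    simpa [R] using tendsto_one_div_add_atTop_nhds_zero_nat (𝕜 := ℝ)
  let v : ℕ → EuclideanSpace ℝ (Fin n) → ℂ := fun k x => χ (R k • x) • φ x
  have hφ1 : ContDiff ℝ 1 φ := φ.smooth 1
  have hsc : ∀ k, ContDiff ℝ 1 fun x : EuclideanSpace ℝ (Fin n) => χ (R k • x) := fun k =>
    hχ.comp (contDiff_const_smul _)
  have hv1 : ∀ k, ContDiff ℝ 1 (v k) := fun k => (hsc k).smul hφ1
  have hcs : ∀ k, HasCompactSupport fun x : EuclideanSpace ℝ (Fin n) => χ (R k • x) := fun k =>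
    hχc.comp_smul (hR k).ne'
  have hvc : ∀ k, HasCompactSupport (v k) := fun k => (hcs k).smul_right
  have hvA : ∀ k, eLpNorm (v k) 2 volume ≤ eLpNorm φ 2 volume := fun k =>
    eLpNorm_mono fun x => by
      rw [norm_smul]
      exact mul_le_of_le_one_left (norm_nonneg _) (hχ1 _)
  have hfd : ∀ k x, ‖fderiv ℝ (v k) x‖ ≤ ‖fderiv ℝ φ x‖ + R k * B * ‖φ x‖ := by
    intro k x
    have h1 : HasFDerivAt (fun x : EuclideanSpace ℝ (Fin n) => χ (R k • x))
        ((fderiv ℝ χ (R k • x)).comp (R k • ContinuousLinearMap.id ℝ _)) x :=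
      ((hχ.differentiable (by simp)) (R k • x)).hasFDerivAt.comp x
        ((hasFDerivAt_id x).const_smul (R k))
    refine (norm_fderiv_smul_le h1.differentiableAt (φ.differentiable x)).trans (add_le_add ?_ ?_)
    · exact mul_le_of_le_one_left (norm_nonneg _) (hχ1 _)
    · rw [h1.fderiv]
      refine mul_le_mul_of_nonneg_right ?_ (norm_nonneg _)
      rw [ContinuousLinearMap.comp_smul, norm_smul, Real.norm_of_nonneg (hR k).le,
        ContinuousLinearMap.comp_id]
      exact mul_le_mul_of_nonneg_left (hB _) (hR k).le
  have hφfd : Continuous (fderiv ℝ φ) := hφ1.continuous_fderiv (by simp)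
  have hvG : ∀ k, eLpNorm (fderiv ℝ (v k)) 2 volume ≤
      eLpNorm (fderiv ℝ φ) 2 volume + ENNReal.ofReal (R k * B) * eLpNorm φ 2 volume := by
    intro k
    have h1 : eLpNorm (fun x => (R k * B) • φ x) 2 volume =
        ENNReal.ofReal (R k * B) * eLpNorm φ 2 volume := by
      rw [show (fun x => (R k * B) • φ x) = (R k * B) • (φ : EuclideanSpace ℝ (Fin n) → ℂ) from rfl,
        eLpNorm_const_smul, Real.enorm_of_nonneg (by have := hR k; positivity)]
    have m1 : AEStronglyMeasurable (fun x => ‖fderiv ℝ φ x‖)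
      (volume : Measure (EuclideanSpace ℝ (Fin n))) := hφfd.norm.aestronglyMeasurable
    have m2 : AEStronglyMeasurable (fun x => ‖(R k * B) • φ x‖)
      (volume : Measure (EuclideanSpace ℝ (Fin n))) :=
      (φ.continuous.const_smul (R k * B)).norm.aestronglyMeasurable
    have h2 := eLpNorm_add_le m1 m2 (p := (2 : ℝ≥0∞)) (by norm_num)
    rw [eLpNorm_norm, eLpNorm_norm, h1] at h2
    have h3 : eLpNorm (fderiv ℝ (v k)) 2 volume ≤
        eLpNorm ((fun x => ‖fderiv ℝ φ x‖) + fun x => ‖(R k * B) • φ x‖) 2 volume :=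
      eLpNorm_mono_real (fun x => by
        simp only [Pi.add_apply, norm_smul, norm_mul, Real.norm_of_nonneg (hR k).le,
          Real.norm_of_nonneg hB0]
        exact hfd k x)
    exact h3.trans h2
  have hA : eLpNorm φ 2 volume ≠ ∞ := (φ.eLpNorm_lt_top 2 volume).ne
  have hae : ∀ᵐ x : EuclideanSpace ℝ (Fin n), Tendsto (fun k => v k x) atTop (𝓝 (φ x)) :=
    Eventually.of_forall fun x => by
      have h1 : Tendsto (fun k => R k • x) atTop (𝓝 0) := by simpa using hR0.smul_const x
      have h2 := (hχ.continuous.tendsto 0).comp h1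
      rw [hχ0] at h2
      simpa [v] using h2.smul_const (φ x)
  have hbd : ∀ k, eLpNorm (v k) r volume ≤ C * eLpNorm φ 2 volume ^ a *
      (eLpNorm (fderiv ℝ φ) 2 volume + ENNReal.ofReal (R k * B) * eLpNorm φ 2 volume) ^ b :=
    fun k => by grw [h (v k) (hv1 k) (hvc k), hvA k, hvG k]
  have hlim : Tendsto (fun k => C * eLpNorm φ 2 volume ^ a *
      (eLpNorm (fderiv ℝ φ) 2 volume + ENNReal.ofReal (R k * B) * eLpNorm φ 2 volume) ^ b) atTop
      (𝓝 (C * eLpNorm φ 2 volume ^ a * eLpNorm (fderiv ℝ φ) 2 volume ^ b)) := by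
    refine ENNReal.Tendsto.const_mul ?_ (Or.inr (ENNReal.mul_ne_top hC
      (ENNReal.rpow_ne_top_of_nonneg ha hA)))
    refine Tendsto.ennrpow_const _ ?_
    have h1 : Tendsto (fun k => ENNReal.ofReal (R k * B)) atTop (𝓝 0) := by
      simpa using ENNReal.tendsto_ofReal (hR0.mul_const B)
    have h2 := ENNReal.Tendsto.mul_const h1 (Or.inr hA)
    simpa using h2.const_add (eLpNorm (fderiv ℝ φ) 2 volume)
  exact eLpNorm_le_of_tendsto_ae (fun k => (hv1 k).continuous.aestronglyMeasurable) hae hbd hlim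

/-- The right-hand side is continuous along the Schwartz approximation; an almost everywhere
convergent subsequence and Fatou's lemma give the left-hand side, including its finiteness. -/
theorem eLpNorm_le_of_forall_schwartz {n : ℕ} {r C : ℝ≥0∞} (hC : C ≠ ∞) {a b : ℝ}
    (ha : 0 ≤ a) (hb : 0 ≤ b)
    (h : ∀ φ : 𝓢(EuclideanSpace ℝ (Fin n), ℂ),
      eLpNorm φ r volume ≤ C * eLpNorm φ 2 volume ^ a * eLpNorm (fderiv ℝ φ) 2 volume ^ b)
    {u : L2n n} (hu : MemSobolev 1 2 (u : 𝓢'(EuclideanSpace ℝ (Fin n), ℂ))) :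
    eLpNorm u r volume ≤ C * ‖u‖ₑ ^ a * ENNReal.ofReal (gradNorm u) ^ b := by
  obtain ⟨φ, h1, h2⟩ := exists_schwartz_tendsto hu
  obtain ⟨ns, hns, hae⟩ := (tendstoInMeasure_of_tendsto_Lp h1).exists_seq_tendsto_ae
  let G : ℕ → ℝ := fun k => Real.sqrt (∑ j : Fin n,
    ‖(∂_{EuclideanSpace.single j (1 : ℝ)} (φ (ns k)) :
      𝓢(EuclideanSpace ℝ (Fin n), ℂ)).toLp 2 volume‖ ^ 2)
  have hG : Tendsto G atTop (𝓝 (gradNorm u)) :=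
    (Real.continuous_sqrt.tendsto _).comp (tendsto_finsetSum _ fun j _ =>
      (((h2 j).comp hns.tendsto_atTop).norm).pow 2)
  have hbd : ∀ k, eLpNorm ((φ (ns k)).toLp 2 volume) r volume ≤
      C * ‖(φ (ns k)).toLp 2 volume‖ₑ ^ a * ENNReal.ofReal (G k) ^ b := fun k => by
    have e := SchwartzMap.coeFn_toLp (φ (ns k)) 2 volume
    rw [eLpNorm_congr_ae e, Lp.enorm_def, eLpNorm_congr_ae e]
    exact (h (φ (ns k))).trans (by gcongr; exact eLpNorm_fderiv_schwartz_le _)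
  have hlim : Tendsto (fun k => C * ‖(φ (ns k)).toLp 2 volume‖ₑ ^ a * ENNReal.ofReal (G k) ^ b)
      atTop (𝓝 (C * ‖u‖ₑ ^ a * ENNReal.ofReal (gradNorm u) ^ b)) := by
    have h3 : Tendsto (fun k => ‖(φ (ns k)).toLp 2 volume‖ₑ) atTop (𝓝 ‖u‖ₑ) :=
      (h1.comp hns.tendsto_atTop).enorm
    have h4 := Tendsto.ennrpow_const b (ENNReal.tendsto_ofReal hG)
    have h5 := Tendsto.ennrpow_const a h3
    exact ENNReal.Tendsto.mul (ENNReal.Tendsto.const_mul h5 (Or.inr hC))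
      (Or.inr (ENNReal.rpow_ne_top_of_nonneg hb ENNReal.ofReal_ne_top)) h4
      (Or.inr (ENNReal.mul_ne_top hC (ENNReal.rpow_ne_top_of_nonneg ha (by simp))))
  exact eLpNorm_le_of_tendsto_ae (fun k => Lp.aestronglyMeasurable _) hae hbd hlim

/-! ### The inequality on `X_β` and the global embedding -/

theorem gagliardo_nirenberg_exponent_nonneg {n : ℕ} {p : ℝ} (hp : 0 < p)
    (hpn : 2 < n → p ≤ 4 / ((n : ℝ) - 2)) : 0 ≤ (4 + p * (2 - (n : ℝ))) / (2 * (p + 2)) := by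
  refine div_nonneg ?_ (by positivity)
  rcases le_or_gt n 2 with h2 | h2
  · have : (n : ℝ) ≤ 2 := by exact_mod_cast h2
    have := mul_nonneg hp.le (sub_nonneg.2 this)
    linarith
  · have h3 : (0 : ℝ) < (n : ℝ) - 2 := by
      have : (2 : ℝ) < n := by exact_mod_cast h2
      linarith
    have := hpn h2
    rw [le_div_iff₀ h3] at this
    linarith

theorem exists_lpNorm_le_norm_rpow_mul_gradNorm_rpow {n : ℕ} (hn : 1 ≤ n) {p : ℝ} (hp : 0 < p)
    (hpn : 2 < n → p ≤ 4 / ((n : ℝ) - 2)) :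
    ∃ C : ℝ, 0 < C ∧ ∀ u : L2n n, MemSobolev 1 2 (u : 𝓢'(EuclideanSpace ℝ (Fin n), ℂ)) →
      MemLp u (ENNReal.ofReal (p + 2)) volume ∧
      lpNorm u (ENNReal.ofReal (p + 2)) volume ≤
        C * ‖u‖ ^ ((4 + p * (2 - (n : ℝ))) / (2 * (p + 2))) *
          gradNorm u ^ ((n : ℝ) * p / (2 * (p + 2))) := by
  obtain ⟨C, hC, h⟩ := exists_eLpNorm_le_of_contDiff_of_hasCompactSupport hn hp hpn
  have hA := gagliardo_nirenberg_exponent_nonneg hp hpn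
  have hθ : 0 ≤ (n : ℝ) * p / (2 * (p + 2)) := by positivity
  have e1 : 1 - (n : ℝ) * p / (2 * (p + 2)) = (4 + p * (2 - (n : ℝ))) / (2 * (p + 2)) := by
    field_simp
    ring
  rw [e1] at h
  -- The added `1` makes the constant strictly positive, as `C` may vanish.
  refine ⟨C.toReal + 1, by positivity, fun u hu => ?_⟩
  have h1 := eLpNorm_le_of_forall_schwartz hC hA hθ
    (eLpNorm_schwartz_le_of_forall_contDiff hC hA hθ h) hu
  have hfin : C * ‖u‖ₑ ^ ((4 + p * (2 - (n : ℝ))) / (2 * (p + 2))) *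
      ENNReal.ofReal (gradNorm u) ^ ((n : ℝ) * p / (2 * (p + 2))) ≠ ∞ :=
    ENNReal.mul_ne_top (ENNReal.mul_ne_top hC (ENNReal.rpow_ne_top_of_nonneg hA (by simp)))
      (ENNReal.rpow_ne_top_of_nonneg hθ (by simp))
  have hm := Lp.aestronglyMeasurable u
  refine ⟨⟨hm, h1.trans_lt hfin.lt_top⟩, ?_⟩
  rw [← toReal_eLpNorm hm]
  refine (ENNReal.toReal_mono hfin h1).trans ?_
  have hg := gradNorm_nonneg u
  rw [ENNReal.toReal_mul, ENNReal.toReal_mul, ← ENNReal.toReal_rpow, ← ENNReal.toReal_rpow,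
    toReal_enorm, ENNReal.toReal_ofReal hg]
  gcongr
  linarith

/-- A factor `‖u‖^κ` is split off, which `κ`'s upper bound permits even when `u = 0`, and is
estimated by the `κ`-th power of the frequency interpolation. -/
theorem gagliardo_nirenberg_of_mem_XSpace {n : ℕ} (hn : 1 ≤ n) {β p κ : ℝ} (hβ : 0 < β)
    (hκ0 : 0 ≤ κ) (hκ : κ ≤ (4 + p * (2 - (n : ℝ))) / (2 * (p + 2))) (hp : 0 < p)
    {C : ℝ} (hC : 0 ≤ C) {u : L2n n} (hu : u ∈ XSpace n β)
    (h : lpNorm u (ENNReal.ofReal (p + 2)) volume ≤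
        C * ‖u‖ ^ ((4 + p * (2 - (n : ℝ))) / (2 * (p + 2))) *
          gradNorm u ^ ((n : ℝ) * p / (2 * (p + 2)))) :
    lpNorm u (ENNReal.ofReal (p + 2)) volume ≤
      C * ‖u‖ ^ ((4 + p * (2 - (n : ℝ))) / (2 * (p + 2)) - κ) *
        gradNorm u ^ ((n : ℝ) * p / (2 * (p + 2)) + κ * β / (β + 1)) *
        ‖invRiesz β u‖ ^ (κ / (β + 1)) := by
  refine h.trans ?_
  have hg := gradNorm_nonneg u
  have h1 : ‖u‖ ^ κ ≤ gradNorm u ^ (κ * β / (β + 1)) * ‖invRiesz β u‖ ^ (κ / (β + 1)) := by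
    refine (Real.rpow_le_rpow (norm_nonneg _)
      (norm_le_gradNorm_rpow_mul_invRiesz_rpow hn hβ hu) hκ0).trans_eq ?_
    rw [Real.mul_rpow (by positivity) (by positivity), ← Real.rpow_mul hg,
      ← Real.rpow_mul (norm_nonneg _)]
    congr 2 <;> ring
  have h2 : ‖u‖ ^ ((4 + p * (2 - (n : ℝ))) / (2 * (p + 2))) =
      ‖u‖ ^ ((4 + p * (2 - (n : ℝ))) / (2 * (p + 2)) - κ) * ‖u‖ ^ κ := by
    rw [← Real.rpow_add_of_nonneg (norm_nonneg _) (sub_nonneg.2 hκ) hκ0, sub_add_cancel]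
  rw [h2, Real.rpow_add_of_nonneg hg (by positivity) (by positivity)]
  calc C * (‖u‖ ^ ((4 + p * (2 - (n : ℝ))) / (2 * (p + 2)) - κ) * ‖u‖ ^ κ) *
        gradNorm u ^ ((n : ℝ) * p / (2 * (p + 2)))
      ≤ C * (‖u‖ ^ ((4 + p * (2 - (n : ℝ))) / (2 * (p + 2)) - κ) *
        (gradNorm u ^ (κ * β / (β + 1)) * ‖invRiesz β u‖ ^ (κ / (β + 1)))) *
        gradNorm u ^ ((n : ℝ) * p / (2 * (p + 2))) := by gcongr
    _ = _ := by ring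

theorem xNorm_nonneg {n : ℕ} (β : ℝ) (u : L2n n) : 0 ≤ xNorm β u := Real.sqrt_nonneg _

theorem norm_le_xNorm {n : ℕ} (β : ℝ) (u : L2n n) : ‖u‖ ≤ xNorm β u :=
  Real.le_sqrt_of_sq_le (by nlinarith [sq_nonneg (gradNorm u), sq_nonneg ‖invRiesz β u‖])

theorem gradNorm_le_xNorm {n : ℕ} (β : ℝ) (u : L2n n) : gradNorm u ≤ xNorm β u :=
  Real.le_sqrt_of_sq_le (by nlinarith [sq_nonneg ‖u‖, sq_nonneg ‖invRiesz β u‖])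

theorem XEmbedsLp_add_two {n : ℕ} (hn : 1 ≤ n) (β : ℝ) {p : ℝ} (hp : 0 < p)
    (hpn : 2 < n → p ≤ 4 / ((n : ℝ) - 2)) : XEmbedsLp n β (ENNReal.ofReal (p + 2)) := by
  obtain ⟨C, hC, h⟩ := exists_lpNorm_le_norm_rpow_mul_gradNorm_rpow hn hp hpn
  refine ⟨C, fun u hu => ⟨(h u hu.1).1, (h u hu.1).2.trans ?_⟩⟩
  have hg := gradNorm_nonneg u
  have hx := xNorm_nonneg β u
  have hA := gagliardo_nirenberg_exponent_nonneg hp hpn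
  have e1 : (4 + p * (2 - (n : ℝ))) / (2 * (p + 2)) + (n : ℝ) * p / (2 * (p + 2)) = 1 := by
    field_simp
    ring
  calc _ ≤ C * xNorm β u ^ ((4 + p * (2 - (n : ℝ))) / (2 * (p + 2))) *
          xNorm β u ^ ((n : ℝ) * p / (2 * (p + 2))) := by
        gcongr
        · exact norm_le_xNorm β u
        · exact gradNorm_le_xNorm β u
    _ = C * xNorm β u := by
        rw [mul_assoc, ← Real.rpow_add_of_nonneg hx hA (by positivity), e1, Real.rpow_one]

/-! ### Weak limits, frequency truncation and compactness in `L²(K)` -/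

/-- Sequential Banach–Alaoglu, moved to `H` by the Riesz representation. -/
theorem exists_subseq_tendsto_inner {H : Type*} [NormedAddCommGroup H] [InnerProductSpace ℂ H]
    [CompleteSpace H] [TopologicalSpace.SeparableSpace H] {u : ℕ → H} {M : ℝ}
    (hu : ∀ k, ‖u k‖ ≤ M) :
    ∃ (φ : ℕ → ℕ) (v : H), StrictMono φ ∧ ∀ w : H,
      Tendsto (fun k => inner ℂ w (u (φ k) - v)) atTop (𝓝 0) := by
  have hmem : ∀ k, StrongDual.toWeakDual (InnerProductSpace.toDual ℂ H (u k)) ∈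
      (WeakDual.toStrongDual ⁻¹' Metric.closedBall (0 : StrongDual ℂ H) M : Set (WeakDual ℂ H)) := by
    intro k
    simpa using hu k
  obtain ⟨a, -, φ, hφ, ha⟩ := WeakDual.isSeqCompact_closedBall ℂ H 0 M hmem
  refine ⟨φ, (InnerProductSpace.toDual ℂ H).symm (WeakDual.toStrongDual a), hφ, fun w => ?_⟩
  have h1 := ((WeakDual.eval_continuous w).tendsto a).comp ha
  have h2 : ∀ k, (StrongDual.toWeakDual (InnerProductSpace.toDual ℂ H (u k))) w = inner ℂ (u k) w :=
    fun k => InnerProductSpace.toDual_apply_apply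
  have h3 : a w = inner ℂ ((InnerProductSpace.toDual ℂ H).symm (WeakDual.toStrongDual a)) w := by
    rw [InnerProductSpace.toDual_symm_apply]
    rfl
  have h4 : Tendsto (fun k => inner ℂ (u (φ k)) w) atTop
      (𝓝 (inner ℂ ((InnerProductSpace.toDual ℂ H).symm (WeakDual.toStrongDual a)) w)) := by
    rw [← h3]
    refine h1.congr fun k => ?_
    exact h2 (φ k)
  have h5 := (Complex.continuous_conj.tendsto _).comp
    (tendsto_sub_nhds_zero_iff.2 h4)
  rw [map_zero] at h5
  refine h5.congr fun k => ?_
  simp only [Function.comp_apply]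
  rw [← inner_sub_left, inner_conj_symm]

/-- Both sides have the same integrals against test functions, since the Fourier integral moves onto
the test function by Fubini. The integral formula is what allows evaluation at a point. -/
theorem fourierInv_ae_eq_of_integrable {n : ℕ} {g : L2n n} (hg : Integrable g volume) :
    (𝓕⁻ g : L2n n) =ᵐ[volume] 𝓕⁻ (g : EuclideanSpace ℝ (Fin n) → ℂ) := by
  have hL : Continuous fun p : EuclideanSpace ℝ (Fin n) × EuclideanSpace ℝ (Fin n) =>
      (-innerₗ (EuclideanSpace ℝ (Fin n))) p.1 p.2 := by
    simpa using! continuous_inner.neg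
  have hcont : Continuous (𝓕⁻ (g : EuclideanSpace ℝ (Fin n) → ℂ)) :=
    VectorFourier.fourierIntegral_continuous Real.continuous_fourierChar hL hg
  refine ae_eq_of_integral_contDiff_smul_eq ((Lp.memLp _).locallyIntegrable one_le_two)
    hcont.locallyIntegrable fun ψ ψ_smooth ψ_cpt => ?_
  have hψ₁ : HasCompactSupport (Complex.ofRealCLM ∘ ψ) := ψ_cpt.comp_left rfl
  have hψ₂ : ContDiff ℝ ((⊤ : ℕ∞) : WithTop ℕ∞) (Complex.ofRealCLM ∘ ψ) :=
    Complex.ofRealCLM.contDiff.comp ψ_smooth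
  set Ψ : 𝓢(EuclideanSpace ℝ (Fin n), ℂ) := hψ₁.toSchwartzMap hψ₂ with hΨ
  have hΨa : ∀ x, Ψ x = (ψ x : ℂ) := fun x => by simp [hΨ]
  have h1 := DFunLike.congr_fun (Lp.fourierInv_toTemperedDistribution_eq g) Ψ
  rw [TemperedDistribution.fourierInv_apply, Lp.toTemperedDistribution_apply,
    Lp.toTemperedDistribution_apply] at h1
  have h2 := VectorFourier.integral_fourierIntegral_smul_eq_flip
    (L := -innerₗ (EuclideanSpace ℝ (Fin n))) (μ := volume) (ν := volume)
    Real.continuous_fourierChar hL Ψ.integrable hg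
  have hflip : (-innerₗ (EuclideanSpace ℝ (Fin n))).flip = -innerₗ (EuclideanSpace ℝ (Fin n)) := by
    ext x y
    simp [real_inner_comm]
  rw [hflip] at h2
  have h3 : ∫ x, (𝓕⁻ Ψ) x • g x = ∫ x, Ψ x • 𝓕⁻ (g : EuclideanSpace ℝ (Fin n) → ℂ) x := by
    rw [SchwartzMap.fourierInv_coe]
    exact h2
  rw [h3] at h1
  simpa [hΨa] using h1.symm

/-- The representing vector is the character `v ↦ e^{-2πi v·x}` cut off to `S`. Point evaluation of
a frequency-restricted function is therefore weakly continuous, with a bound uniform in `x`. -/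
theorem exists_inner_eq_fourierInv_indicator {n : ℕ} {S : Set (EuclideanSpace ℝ (Fin n))}
    (hS : MeasurableSet S) (hSfin : volume S ≠ ∞) (x : EuclideanSpace ℝ (Fin n)) :
    ∃ e : L2n n, ‖e‖ₑ ≤ volume S ^ (1 / 2 : ℝ) ∧ ∀ g : L2n n,
      𝓕⁻ (S.indicator g) x = inner ℂ e g := by
  let f : EuclideanSpace ℝ (Fin n) → ℂ := fun v => (Real.fourierChar (-(inner ℝ v x : ℝ)) : ℂ)
  have hfc : Continuous f := by
    have h : Continuous fun v : EuclideanSpace ℝ (Fin n) => Real.fourierChar (-(inner ℝ v x : ℝ)) :=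
      Real.continuous_fourierChar.comp (by fun_prop)
    exact continuous_subtype_val.comp h
  have hfn : ∀ v, ‖f v‖ₑ = 1 := fun v => by
    rw [← ofReal_norm, Circle.norm_coe, ENNReal.ofReal_one]
  have hmem : MemLp (S.indicator f) 2 volume := by
    rw [memLp_indicator_iff_restrict hS]
    have : IsFiniteMeasure (volume.restrict S) := ⟨by simpa using hSfin.lt_top⟩
    exact MemLp.of_bound hfc.aestronglyMeasurable 1 (Eventually.of_forall fun v => (Circle.norm_coe _).le)
  refine ⟨hmem.toLp _, ?_, fun g => ?_⟩
  · rw [Lp.enorm_toLp, eLpNorm_indicator_eq_eLpNorm_restrict hS]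
    refine (eLpNorm_le_of_ae_enorm_bound (C := 1)
      (Eventually.of_forall fun v => (hfn v).le)).trans ?_
    simp
  · rw [L2.inner_def, Real.fourierInv_eq]
    refine integral_congr_ae ?_
    filter_upwards [hmem.coeFn_toLp] with v hv
    rw [hv]
    by_cases hvS : v ∈ S
    · simp only [Set.indicator_of_mem hvS, RCLike.inner_apply, f]
      rw [← Circle.coe_inv_eq_conj, ← AddChar.map_neg_eq_inv, neg_neg, mul_comm]
      rfl
    · simp [Set.indicator_of_notMem hvS]

/-- The frequency restriction `𝓕⁻ (1_S 𝓕 g)` of `g`. -/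
noncomputable def freqRestrict {n : ℕ} {S : Set (EuclideanSpace ℝ (Fin n))} (hS : MeasurableSet S)
    (g : L2n n) : L2n n :=
  𝓕⁻ (((Lp.memLp (𝓕 g : L2n n)).indicator hS).toLp _ : L2n n)

/-- Weak convergence gives pointwise convergence of the restrictions, bounded by `|S|^{1/2} M`;
dominated convergence applies on `K`. -/
theorem tendsto_eLpNorm_freqRestrict {n : ℕ} {S K : Set (EuclideanSpace ℝ (Fin n))}
    (hS : MeasurableSet S) (hSfin : volume S ≠ ∞) (hK : IsCompact K) {w : ℕ → L2n n} {M : ℝ}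
    (hM : ∀ k, ‖w k‖ ≤ M) (hw : ∀ g : L2n n, Tendsto (fun k => inner ℂ g (w k)) atTop (𝓝 0)) :
    Tendsto (fun k => eLpNorm (freqRestrict hS (w k)) 2 (volume.restrict K)) atTop (𝓝 0) := by
  choose e he1 he2 using exists_inner_eq_fourierInv_indicator hS hSfin
  have hae : ∀ k, (freqRestrict hS (w k) : L2n n) =ᵐ[volume]
      fun x => inner ℂ (e x) (𝓕 (w k) : L2n n) := by
    intro k
    set m := (Lp.memLp (𝓕 (w k) : L2n n)).indicator hS with hm
    have hint : Integrable (m.toLp _ : L2n n) volume := by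
      refine (integrable_congr m.coeFn_toLp).2 ((integrable_indicator_iff hS).2 ?_)
      have : IsFiniteMeasure (volume.restrict S) := ⟨by simpa using hSfin.lt_top⟩
      exact (Lp.memLp (𝓕 (w k) : L2n n)).restrict S |>.integrable one_le_two
    filter_upwards [fourierInv_ae_eq_of_integrable hint] with x hx
    rw [freqRestrict, hx, Real.fourierInv_congr_ae m.coeFn_toLp, he2]
  have hbound : ∀ k x, ‖inner ℂ (e x) (𝓕 (w k) : L2n n)‖ₑ ≤
      volume S ^ (1 / 2 : ℝ) * ENNReal.ofReal M := by
    intro k x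
    have h1 := ENNReal.ofReal_le_ofReal (norm_inner_le_norm (𝕜 := ℂ) (e x) (𝓕 (w k) : L2n n))
    rw [ofReal_norm, ENNReal.ofReal_mul (norm_nonneg _), ofReal_norm, Lp.norm_fourier_eq] at h1
    exact h1.trans (mul_le_mul' (he1 x) (ENNReal.ofReal_le_ofReal (hM k)))
  have hlim : ∀ x, Tendsto (fun k => inner ℂ (e x) (𝓕 (w k) : L2n n)) atTop (𝓝 0) := by
    intro x
    refine (hw (𝓕⁻ (e x) : L2n n)).congr fun k => ?_
    rw [← Lp.inner_fourier_eq, FourierTransform.fourier_fourierInv_eq]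
  have hC : volume S ^ (1 / 2 : ℝ) * ENNReal.ofReal M ≠ ∞ :=
    ENNReal.mul_ne_top (ENNReal.rpow_ne_top_of_nonneg (by norm_num) hSfin) ENNReal.ofReal_ne_top
  have hDCT := tendsto_lintegral_of_dominated_convergence' (μ := volume.restrict K)
    (F := fun k x => ‖freqRestrict hS (w k) x‖ₑ ^ (2 : ℝ)) (f := fun _ => 0)
    (fun _ => (volume S ^ (1 / 2 : ℝ) * ENNReal.ofReal M) ^ (2 : ℝ))
    (fun k => (Lp.aestronglyMeasurable _).restrict.enorm.pow_const _)
    (fun k => by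
      filter_upwards [ae_restrict_of_ae (hae k)] with x hx
      rw [hx]
      exact ENNReal.rpow_le_rpow (hbound k x) zero_le_two)
    (by
      rw [lintegral_const]
      exact ENNReal.mul_ne_top (ENNReal.rpow_ne_top_of_nonneg zero_le_two hC)
        (by simpa using hK.measure_lt_top.ne))
    (by
      filter_upwards [ae_restrict_of_ae (ae_all_iff.2 hae)] with x hx
      simp_rw [hx]
      have := ((hlim x).enorm).ennrpow_const 2
      simpa using this)
  have h2 := hDCT.ennrpow_const (1 / 2)
  simp only [lintegral_zero] at h2
  rw [ENNReal.zero_rpow_of_pos (by norm_num)] at h2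
  refine h2.congr fun k => ?_
  rw [eLpNorm_eq_lintegral_rpow_enorm_toReal (by simp) (by simp)]
  simp

theorem eLpNorm_sub_freqRestrict {n : ℕ} {S : Set (EuclideanSpace ℝ (Fin n))}
    (hS : MeasurableSet S) (g : L2n n) :
    eLpNorm (fun x => g x - freqRestrict hS g x) 2 volume =
      eLpNorm (Sᶜ.indicator (𝓕 g : L2n n)) 2 volume := by
  set m := (Lp.memLp (𝓕 g : L2n n)).indicator hS with hm
  have h1 : eLpNorm (fun x => g x - freqRestrict hS g x) 2 volume = ‖g - freqRestrict hS g‖ₑ := by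
    rw [Lp.enorm_def]
    exact eLpNorm_congr_ae (Lp.coeFn_sub _ _).symm
  have h2 : (𝓕 (g - freqRestrict hS g) : L2n n) = 𝓕 g - m.toLp _ := by
    have h3 : (𝓕 (𝓕⁻ (m.toLp _ : L2n n) : L2n n) : L2n n) = m.toLp _ :=
      FourierTransform.fourier_fourierInv_eq _
    rw [← h3]
    exact (Lp.fourierTransformₗᵢ _ ℂ).map_sub g (freqRestrict hS g)
  rw [h1, ← Lp_enorm_fourier, h2, Lp.enorm_def]
  refine eLpNorm_congr_ae ?_
  filter_upwards [Lp.coeFn_sub (𝓕 g : L2n n) (m.toLp _), m.coeFn_toLp] with x h3 h4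
  rw [h3, Pi.sub_apply, h4]
  by_cases hx : x ∈ S <;> simp [hx]

/-- Outside `S` one has `N ≤ |ξ| ≤ |2πξ|`, so `N |û|` is dominated by the symbol side of the
gradient. -/
theorem eLpNorm_indicator_fourier_le_gradNorm {n : ℕ} {S : Set (EuclideanSpace ℝ (Fin n))}
    (hS : MeasurableSet S) {N : ℝ} (hN : 0 < N) (hSN : Metric.ball 0 N ⊆ S) {u : L2n n}
    (hu : MemSobolev 1 2 (u : 𝓢'(EuclideanSpace ℝ (Fin n), ℂ))) :
    eLpNorm (Sᶜ.indicator (𝓕 u : L2n n)) 2 volume ≤ ENNReal.ofReal (gradNorm u / N) := by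
  have hg := gradNorm_nonneg u
  have h1 : (ENNReal.ofReal N * eLpNorm (Sᶜ.indicator (𝓕 u : L2n n)) 2 volume) ^ 2 ≤
      ENNReal.ofReal (gradNorm u) ^ 2 := by
    have hm : AEStronglyMeasurable (Sᶜ.indicator (𝓕 u : L2n n)) volume :=
      (Lp.aestronglyMeasurable _).indicator hS.compl
    have h2 : eLpNorm (Sᶜ.indicator (𝓕 u : L2n n)) 2 volume ^ 2 =
        ∫⁻ x, ‖Sᶜ.indicator (𝓕 u : L2n n) x‖ₑ ^ 2 := by
      rw [← ENNReal.rpow_natCast, eLpNorm_eq_lintegral_rpow_enorm_toReal (by simp) (by simp),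
        ← ENNReal.rpow_mul]
      simp
    rw [gradNorm_sq_eq_lintegral hu, mul_pow, h2, ← lintegral_const_mul'' _ (hm.enorm.pow_const 2)]
    refine lintegral_mono fun ξ => ?_
    by_cases hξ : ξ ∈ S
    · simp [hξ]
    · have h3 : N ≤ ‖ξ‖ := by
        by_contra! hlt
        exact hξ (hSN (by simpa using hlt))
      rw [Set.indicator_of_mem (by simpa using hξ)]
      gcongr
      exact h3.trans (le_mul_of_one_le_left (norm_nonneg _) (by nlinarith [Real.pi_gt_three]))
  rw [ENNReal.ofReal_div_of_pos hN, ENNReal.le_div_iff_mul_le (by simp [hN]) (by simp), mul_comm]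
  exact (ENNReal.pow_le_pow_left_iff two_ne_zero).1 h1

theorem exists_subseq_tendsto_eLpNorm_two {n : ℕ} {u : ℕ → L2n n} {M : ℝ}
    (hu : ∀ k, MemSobolev 1 2 (u k : 𝓢'(EuclideanSpace ℝ (Fin n), ℂ)))
    (hM : ∀ k, ‖u k‖ ≤ M) (hG : ∀ k, gradNorm (u k) ≤ M) :
    ∃ (φ : ℕ → ℕ) (v : L2n n), StrictMono φ ∧
      ∀ K : Set (EuclideanSpace ℝ (Fin n)), IsCompact K →
        Tendsto (fun k => eLpNorm (fun x => u (φ k) x - v x) 2 (volume.restrict K)) atTop (𝓝 0) := by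
  have : Fact ((2 : ℝ≥0∞) ≠ ∞) := ⟨by simp⟩
  obtain ⟨φ, v, hφ, hweak⟩ := exists_subseq_tendsto_inner hM
  refine ⟨φ, v, hφ, fun K hK => ?_⟩
  have hM0 : 0 ≤ M := (norm_nonneg _).trans (hM 0)
  rw [ENNReal.tendsto_nhds_zero]
  intro ε hε
  rcases eq_or_ne ε ∞ with rfl | hεtop
  · exact Eventually.of_forall fun _ => le_top
  have hε3 : ε / 3 ≠ 0 := (ENNReal.div_pos hε.ne' (by simp)).ne'
  -- No gradient bound for the weak limit `v` is used: its tail is made small by a set `s` of finite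
  -- measure adapted to `v`, and the ball of radius `N` treats the sequence uniformly.
  obtain ⟨s, hs, hsfin, hsv⟩ := (Lp.memLp (𝓕 v : L2n n)).exists_eLpNorm_indicator_compl_lt
    (by simp) hε3
  have hε3' : 0 < (ε / 3).toReal := ENNReal.toReal_pos hε3 (ENNReal.div_lt_top hεtop (by simp)).ne
  set N : ℝ := M / (ε / 3).toReal + 1 with hN
  have hN0 : 0 < N := by positivity
  have hMN : ENNReal.ofReal (M / N) ≤ ε / 3 := by
    refine ENNReal.ofReal_le_of_le_toReal ?_
    rw [div_le_iff₀ hN0, hN, mul_add, mul_div_cancel₀ _ hε3'.ne']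
    linarith
  set S := s ∪ Metric.ball (0 : EuclideanSpace ℝ (Fin n)) N with hSdef
  have hS : MeasurableSet S := hs.union measurableSet_ball
  have hSfin : volume S ≠ ∞ :=
    ((measure_union_le _ _).trans_lt (ENNReal.add_lt_top.2 ⟨hsfin, measure_ball_lt_top⟩)).ne
  have hlow := tendsto_eLpNorm_freqRestrict hS hSfin hK (w := fun k => u (φ k) - v) (M := M + ‖v‖)
    (fun k => (norm_sub_le _ _).trans (by gcongr; exact hM _)) hweak
  filter_upwards [ENNReal.tendsto_nhds_zero.1 hlow (ε / 3) (pos_iff_ne_zero.2 hε3)] with k hk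
  set w := u (φ k) - v with hw
  have htail : eLpNorm (fun x => w x - freqRestrict hS w x) 2 (volume.restrict K) ≤ ε / 3 + ε / 3 := by
    refine (eLpNorm_restrict_le _ _ _ _).trans ?_
    rw [eLpNorm_sub_freqRestrict]
    have hF : (𝓕 w : L2n n) = 𝓕 (u (φ k)) - 𝓕 v :=
      (Lp.fourierTransformₗᵢ _ ℂ).map_sub (u (φ k)) v
    have h1 : (Sᶜ.indicator (𝓕 w : L2n n)) =ᵐ[volume]
        Sᶜ.indicator (𝓕 (u (φ k)) : L2n n) - Sᶜ.indicator (𝓕 v : L2n n) := by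
      rw [hF]
      filter_upwards [Lp.coeFn_sub (𝓕 (u (φ k)) : L2n n) (𝓕 v)] with x hx
      by_cases hxS : x ∈ S
      · simp [hxS]
      · rw [Pi.sub_apply] at hx ⊢
        simp only [Set.indicator_of_mem (Set.mem_compl hxS)]
        exact hx
    rw [eLpNorm_congr_ae h1]
    refine (eLpNorm_sub_le ((Lp.aestronglyMeasurable _).indicator hS.compl)
      ((Lp.aestronglyMeasurable _).indicator hS.compl) (by norm_num)).trans (add_le_add ?_ ?_)
    · refine (eLpNorm_indicator_fourier_le_gradNorm hS hN0 Set.subset_union_right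
        (hu (φ k))).trans (le_trans (ENNReal.ofReal_le_ofReal ?_) hMN)
      gcongr
      exact hG _
    · refine le_trans (eLpNorm_mono fun x => ?_) hsv.le
      by_cases hxs : x ∈ s
      · simp [hSdef, hxs]
      · rw [Set.indicator_of_mem (s := sᶜ) (by simpa using hxs)]
        exact norm_indicator_le_norm_self _ _
  have h2 : eLpNorm (fun x => u (φ k) x - v x) 2 (volume.restrict K) =
      eLpNorm ((fun x => freqRestrict hS w x) + fun x => w x - freqRestrict hS w x) 2 (volume.restrict K) := by
    refine eLpNorm_congr_ae (ae_restrict_of_ae ?_)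
    filter_upwards [Lp.coeFn_sub (u (φ k)) v] with x hx
    rw [Pi.sub_apply] at hx
    simp only [Pi.add_apply, add_sub_cancel]
    exact hx.symm
  rw [h2]
  have hmw := (Lp.aestronglyMeasurable (freqRestrict hS w)).restrict (s := K)
  refine (eLpNorm_add_le hmw ((Lp.aestronglyMeasurable w).restrict.sub hmw)
    (by norm_num)).trans ((add_le_add hk htail).trans_eq ?_)
  rw [← add_assoc, ENNReal.add_thirds]

/-! ### From `L²(K)` to `L^q(K)` -/

theorem exists_gt_XEmbedsLp {n : ℕ} (hn : 1 ≤ n) (β : ℝ) {q : ℝ}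
    (hq : 2 < n → q < 2 * (n : ℝ) / ((n : ℝ) - 2)) :
    ∃ s : ℝ, q < s ∧ 2 < s ∧ XEmbedsLp n β (ENNReal.ofReal s) := by
  rcases le_or_gt n 2 with h2 | h2
  · have hp : 0 < max q 2 - 1 := by have := le_max_right q 2; linarith
    refine ⟨max q 2 - 1 + 2, ?_, by linarith, XEmbedsLp_add_two hn β hp fun h => absurd h (by omega)⟩
    have := le_max_left q 2
    linarith
  · have h3 : (0 : ℝ) < (n : ℝ) - 2 := by
      have : (2 : ℝ) < n := by exact_mod_cast h2
      linarith
    have hp : 0 < 4 / ((n : ℝ) - 2) := by positivity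
    refine ⟨4 / ((n : ℝ) - 2) + 2, ?_, by linarith, XEmbedsLp_add_two hn β hp fun _ => le_rfl⟩
    refine (hq h2).trans_eq ?_
    field_simp
    ring

theorem eLpNorm_restrict_le_eLpNorm_mul {α E : Type*} [MeasurableSpace α] {μ : Measure α}
    [NormedAddCommGroup E] {K : Set α} {f : α → E} (hf : AEStronglyMeasurable f (μ.restrict K))
    {q s : ℝ} (hq : 0 < q) (hqs : q ≤ s) :
    eLpNorm f (ENNReal.ofReal q) (μ.restrict K) ≤
      eLpNorm f (ENNReal.ofReal s) (μ.restrict K) * μ K ^ (1 / q - 1 / s) := by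
  have := eLpNorm_le_eLpNorm_mul_rpow_measure_univ (ENNReal.ofReal_le_ofReal hqs) hf
  simpa [ENNReal.toReal_ofReal hq.le, ENNReal.toReal_ofReal (hq.le.trans hqs)] using this

theorem tendsto_eLpNorm_restrict_of_tendsto_two {α E : Type*} [MeasurableSpace α] {μ : Measure α}
    [NormedAddCommGroup E] {K : Set α} (hK : μ K ≠ ∞) {f : ℕ → α → E}
    (hf : ∀ k, AEStronglyMeasurable (f k) (μ.restrict K)) {q s : ℝ} (hq : 0 < q) (hqs : q < s)
    (hs : 2 < s) {B : ℝ≥0∞} (hB : B ≠ ∞)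
    (hfB : ∀ k, eLpNorm (f k) (ENNReal.ofReal s) (μ.restrict K) ≤ B)
    (hlim : Tendsto (fun k => eLpNorm (f k) 2 (μ.restrict K)) atTop (𝓝 0)) :
    Tendsto (fun k => eLpNorm (f k) (ENNReal.ofReal q) (μ.restrict K)) atTop (𝓝 0) := by
  -- Since `q` may be below `2`, an intermediate `r` above both is used: `L^q(K)` is controlled by
  -- `L^r(K)`, and `L^r` is interpolated between `L²` and `L^s`.
  obtain ⟨r, hr1, hrs⟩ := exists_between (max_lt hqs hs)
  have hqr : q < r := (le_max_left q 2).trans_lt hr1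
  have h2r : 2 < r := (le_max_right q 2).trans_lt hr1
  have hr0 : 0 < r := by linarith
  have hs0 : 0 < s := by linarith
  -- The solution of `1/r = (1 - t)/2 + t/s`.
  set t : ℝ := (s * (r - 2)) / (r * (s - 2)) with ht
  have hsub : 0 < s - 2 := by linarith
  have ht0 : 0 < t := by
    have : 0 < r - 2 := by linarith
    positivity
  have ht1 : t < 1 := by
    rw [ht, div_lt_one (by positivity)]
    nlinarith
  have hexp := inv_ofReal_eq_interp hr0 hs0 ht0.le ht1.le (by
    rw [ht]
    field_simp
    ring)
  have hbd : ∀ k, eLpNorm (f k) (ENNReal.ofReal q) (μ.restrict K) ≤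
      eLpNorm (f k) 2 (μ.restrict K) ^ (1 - t) * (B ^ t * μ K ^ (1 / q - 1 / r)) := fun k => by
    refine (eLpNorm_restrict_le_eLpNorm_mul (hf k) hq hqr.le).trans ?_
    grw [eLpNorm_le_eLpNorm_rpow_mul_eLpNorm_rpow (hf k) ht0 ht1.le hexp, hfB k, mul_assoc]
  refine tendsto_of_tendsto_of_tendsto_of_le_of_le tendsto_const_nhds ?_ (fun _ => zero_le) hbd
  have hc : B ^ t * μ K ^ (1 / q - 1 / r) ≠ ∞ :=
    ENNReal.mul_ne_top (ENNReal.rpow_ne_top_of_nonneg ht0.le hB)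
      (ENNReal.rpow_ne_top_of_nonneg (sub_nonneg.2 (one_div_le_one_div_of_le hq hqr.le)) hK)
  have h1 := hlim.ennrpow_const (1 - t)
  rw [ENNReal.zero_rpow_of_pos (sub_pos.2 ht1)] at h1
  simpa using ENNReal.Tendsto.mul_const h1 (Or.inr hc)

theorem XEmbedsCompactlyLpLoc_of_lt {n : ℕ} (hn : 1 ≤ n) (β : ℝ) {q : ℝ} (hq1 : 1 ≤ q)
    (hq : 2 < n → q < 2 * (n : ℝ) / ((n : ℝ) - 2)) :
    XEmbedsCompactlyLpLoc n β (ENNReal.ofReal q) := by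
  obtain ⟨s, hqs, hs2, C, hC⟩ := exists_gt_XEmbedsLp hn β hq
  have hq0 : 0 < q := by linarith
  have hqs' := ENNReal.ofReal_le_ofReal hqs.le
  have hfinK : ∀ K : Set (EuclideanSpace ℝ (Fin n)), IsCompact K →
      IsFiniteMeasure (volume.restrict K) := fun K hK => ⟨by simpa using hK.measure_lt_top⟩
  refine ⟨fun K hK => ?_, fun u hu ⟨M, hM⟩ => ?_⟩
  · have := hfinK K hK
    have hexp : 0 ≤ 1 / q - 1 / s := sub_nonneg.2 (one_div_le_one_div_of_le hq0 hqs.le)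
    refine ⟨C * (volume K ^ (1 / q - 1 / s)).toReal, fun u hu => ?_⟩
    obtain ⟨h1, h2⟩ := hC u hu
    refine ⟨(h1.restrict K).mono_exponent hqs', ?_⟩
    have hm := h1.1.restrict (s := K)
    have h3 := (eLpNorm_restrict_le_eLpNorm_mul hm hq0 hqs.le).trans
      (mul_le_mul_left (eLpNorm_restrict_le u (ENNReal.ofReal s) volume K) _)
    have h4 := ENNReal.toReal_mono (ENNReal.mul_ne_top h1.2.ne
      (ENNReal.rpow_ne_top_of_nonneg hexp hK.measure_lt_top.ne)) h3
    rw [ENNReal.toReal_mul, toReal_eLpNorm hm, toReal_eLpNorm h1.1] at h4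
    refine h4.trans ((mul_le_mul_of_nonneg_right h2 ENNReal.toReal_nonneg).trans_eq ?_)
    ring
  · obtain ⟨φ, v, hφ, hv⟩ := exists_subseq_tendsto_eLpNorm_two (fun k => (hu k).1)
      (fun k => (norm_le_xNorm β (u k)).trans (hM k))
      (fun k => (gradNorm_le_xNorm β (u k)).trans (hM k))
    refine ⟨φ, v, hφ, fun K hK => ?_⟩
    have := hfinK K hK
    set B : ℝ≥0∞ := ENNReal.ofReal (|C| * M) with hB
    have huB : ∀ k, eLpNorm (u k) (ENNReal.ofReal s) (volume.restrict K) ≤ B := fun k => by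
      obtain ⟨h1, h2⟩ := hC (u k) (hu k)
      refine (eLpNorm_restrict_le _ _ _ _).trans ?_
      rw [← ofReal_lpNorm h1]
      refine ENNReal.ofReal_le_ofReal (h2.trans ?_)
      have hx := xNorm_nonneg β (u k)
      gcongr
      · exact le_abs_self C
      · exact hM k
    have hum : ∀ k, AEStronglyMeasurable (u k) (volume.restrict K) := fun k =>
      (Lp.aestronglyMeasurable (u k)).restrict
    have hvm : AEStronglyMeasurable v (volume.restrict K) := (Lp.aestronglyMeasurable v).restrict
    -- A priori `v` is only in `L²`. An almost everywhere convergent subsequence and Fatou's lemma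
    -- transfer the uniform `L^s(K)` bound to it.
    obtain ⟨ns, -, hae⟩ := (tendstoInMeasure_of_tendsto_eLpNorm two_ne_zero
      (fun k => hum (φ k)) hvm (hv K hK)).exists_seq_tendsto_ae
    have hvB : eLpNorm v (ENNReal.ofReal s) (volume.restrict K) ≤ B :=
      eLpNorm_le_of_tendsto_ae (fun k => hum (φ (ns k))) hae (fun k => huB (φ (ns k)))
        tendsto_const_nhds
    have hvs : MemLp v (ENNReal.ofReal s) (volume.restrict K) :=
      ⟨hvm, hvB.trans_lt ENNReal.ofReal_lt_top⟩
    have h1s : 1 ≤ ENNReal.ofReal s := by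
      rw [← ENNReal.ofReal_one]
      exact ENNReal.ofReal_le_ofReal (by linarith)
    exact ⟨hvs.mono_exponent hqs', tendsto_eLpNorm_restrict_of_tendsto_two hK.measure_lt_top.ne
      (fun k => (hum (φ k)).sub hvm) hq0 hqs hs2 (B := B + B)
      (ENNReal.add_ne_top.2 ⟨ENNReal.ofReal_ne_top, ENNReal.ofReal_ne_top⟩)
      (fun k => (eLpNorm_sub_le (hum (φ k)) hvm h1s).trans (add_le_add (huB _) hvB)) (hv K hK)⟩

theorem mainTheorem11 (n : ℕ) (hn : 1 ≤ n) (β : ℝ) (hβ : 0 < β) :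
    (∀ p : ℝ, 0 < p → (2 < n → p ≤ 4 / ((n : ℝ) - 2)) →
      (∃ ϱ : ℝ, 0 < ϱ ∧ ∀ κ : ℝ, 0 ≤ κ →
        κ ≤ (4 + p * (2 - (n : ℝ))) / (2 * (p + 2)) →
        ∀ u ∈ XSpace n β,
          MemLp u (ENNReal.ofReal (p + 2)) volume ∧
          lpNorm u (ENNReal.ofReal (p + 2)) volume ≤
            ϱ * ‖u‖ ^ ((4 + p * (2 - (n : ℝ))) / (2 * (p + 2)) - κ) *
              gradNorm u ^ ((n : ℝ) * p / (2 * (p + 2)) + κ * β / (β + 1)) *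
              ‖invRiesz β u‖ ^ (κ / (β + 1))) ∧
      XEmbedsLp n β (ENNReal.ofReal (p + 2))) ∧
    (∀ q : ℝ, 1 ≤ q → (2 < n → q < 2 * (n : ℝ) / ((n : ℝ) - 2)) →
      XEmbedsCompactlyLpLoc n β (ENNReal.ofReal q)) := by
  refine ⟨fun p hp hpn => ⟨?_, XEmbedsLp_add_two hn β hp hpn⟩,
    fun q hq1 hq => XEmbedsCompactlyLpLoc_of_lt hn β hq1 hq⟩
  obtain ⟨C, hC, h⟩ := exists_lpNorm_le_norm_rpow_mul_gradNorm_rpow hn hp hpn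
  exact ⟨C, hC, fun κ hκ0 hκ u hu => ⟨(h u hu.1).1,
    gagliardo_nirenberg_of_mem_XSpace hn hβ hκ0 hκ hp hC.le hu (h u hu.1).2⟩⟩
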